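/- **Theorem.** All graphs below may have loops and parallel edges; a *leaf* is a univalent vertex, and all other vertices are trivalent (a loop counts twice at its vertex). For $g\ge 1$ let $\Gamma(g,1)$ be the chain that starts with a vertex carrying a loop, continues with $g-1$ bigons (pairs of vertices joined by two parallel edges), consecutive pieces being joined by a single edge, and ends in one leaf edge; it has first Betti number $g$. For $g,n\ge 1$ let $\Gamma(g,n)$ be obtained from $\Gamma(g,1)$ by identifying its leaf edge with a leaf edge of a trivalent tree with $n+1$ leaves (a single edge if $n=1$); let $\Gamma(0,n)$, $n\ge 3$, be a trivalent tree with $n$ leaves; and let $\Gamma(g,0)$, $g\ge 2$, be the chain of $g-2$ bigons with a loop at both ends. The trivalent tree may be chosen arbitrarily. Thus $\Gamma(g,n)$ has $n$ leaves and first Betti number $g$, and it is defined whenever $2g-2+n>0$. For an integer $L\ge 0$ let $P_{g,n}(L)$ be the set of weightings of the edges of $\Gamma(g,n)$ by non-negative integers such that at every trivalent vertex $v$ the weights $w_1,w_2,w_3$ of the three edge-ends at $v$ satisfy $$w_1+w_2+w_3\le 2L,\qquad |w_1-w_2|\le w_3\le w_1+w_2,\qquad w_1+w_2+w_3\in 2\mathbb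 Z .$$ Let $P_{g,n}=\bigsqcup_{L\ge 0}P_{g,n}(L)$ be the graded semigroup with edge-wise addition $P_{g,n}(L)\times P_{g,n}(K)\to P_{g,n}(L+K)$, and let $\mathbb C[P_{g,n}]$ be its semigroup algebra, graded by the level $L$. Then: 1. $\mathbb C[P_{g,n}]$ is generated as a $\mathbb C$-algebra by the lattice points in $P_{g,n}(1)$ and $P_{g,n}(2)$. 2. Let $\mathbb C[x_p : p\in P_{g,n}(1)\sqcup P_{g,n}(2)]$ be the polynomial ring in which $x_p$ has as its degree the level ($1$ or $2$) of $p$. The ideal of relations, that is, the kernel of the map to $\mathbb C[P_{g,n}]$ with $x_p\mapsto p$, is generated by homogeneous elements of degree at most $4$. For $n=0$ and every $g\ge1$, both claims hold as well for $P_{g,0}$ understood as the semigroup of all elements of $P_{g,1}$ with weight $0$ on the leaf edge of $\Gamma(g,1)$; this includes the case $(g,n)=(1,0)$. -/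

import Mathlib

/-- The incidence data of a (multi)graph whose inner vertices are trivalent: `V` is the set of
trivalent vertices, `E` the set of edges, and `inc v` lists the three edge-ends at `v`, so a loop at
`v` is listed twice. A leaf edge is an edge with only one of its ends listed; the univalent end
points of leaf edges carry no condition and are not recorded. -/
structure TrivalentGraph where
  V : Type
  E : Type
  inc : V → Fin 3 → E

/-- The lattice points of the polytopes `P_Γ(L)` for all levels `L`, as pairs (weighting, level),
with edge-wise addition: integer weightings that are non-negative and satisfy at every trivalent
vertex the level condition, the triangle inequalities and the even-sum condition. -/
def TrivalentGraph.latticePoints (Γ : TrivalentGraph) : AddSubmonoid ((Γ.E → ℤ) × ℕ) where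
  carrier := {p | (∀ e, 0 ≤ p.1 e) ∧ ∀ v,
    p.1 (Γ.inc v 0) + p.1 (Γ.inc v 1) + p.1 (Γ.inc v 2) ≤ 2 * (p.2 : ℤ) ∧
    |p.1 (Γ.inc v 0) - p.1 (Γ.inc v 1)| ≤ p.1 (Γ.inc v 2) ∧
    p.1 (Γ.inc v 2) ≤ p.1 (Γ.inc v 0) + p.1 (Γ.inc v 1) ∧
    Even (p.1 (Γ.inc v 0) + p.1 (Γ.inc v 1) + p.1 (Γ.inc v 2))}
  zero_mem' := by simp
  add_mem' := by
    rintro p q ⟨hp, hp'⟩ ⟨hq, hq'⟩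
    refine ⟨fun e => add_nonneg (hp e) (hq e), fun v => ?_⟩
    obtain ⟨a1, a2, a3, a4⟩ := hp' v
    obtain ⟨b1, b2, b3, b4⟩ := hq' v
    rw [abs_le] at a2 b2
    simp only [Prod.fst_add, Prod.snd_add, Pi.add_apply, Nat.cast_add, abs_le]
    refine ⟨by linarith, ⟨by linarith, by linarith⟩, by linarith, ?_⟩
    rw [Int.even_iff] at a4 b4 ⊢
    omega

/-- A graph with a distinguished leaf edge `root`, to which further pieces can be attached. -/
structure RootedGraph extends TrivalentGraph where
  root : E

namespace RootedGraph

/-- A single edge without trivalent vertices; both of its ends are leaves. -/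
def line : RootedGraph where
  V := Empty
  E := Unit
  inc := fun v => v.elim
  root := ()

/-- One vertex with a loop (the edge `true`) and a leaf edge (the edge `false`). -/
def loop : RootedGraph where
  V := Unit
  E := Bool
  inc := fun _ => ![false, true, true]
  root := false

/-- Attach a bigon at the free end of the root of `A`: a vertex at which the root of `A` and two new
parallel edges `0`, `1` meet, and a vertex at which these two and the new root `2` meet. -/
def bigon (A : RootedGraph) : RootedGraph where
  V := A.V ⊕ Fin 2
  E := A.E ⊕ Fin 3
  inc := Sum.elim (fun v i => Sum.inl (A.inc v i))
    ![![Sum.inl A.root, Sum.inr 0, Sum.inr 1], ![Sum.inr 2, Sum.inr 0, Sum.inr 1]]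
  root := Sum.inr 2

/-- Join the roots of `A` and `B` at a new vertex, the third edge at which is the new root `none`. -/
def node (A B : RootedGraph) : RootedGraph where
  V := Option (A.V ⊕ B.V)
  E := Option (A.E ⊕ B.E)
  inc := fun v => v.elim ![none, some (Sum.inl A.root), some (Sum.inr B.root)]
    (Sum.elim (fun v i => some (Sum.inl (A.inc v i))) (fun v i => some (Sum.inr (B.inc v i))))
  root := none

/-- Attach a vertex with a new loop `none` at the free end of the root of `A`. -/
def close (A : RootedGraph) : TrivalentGraph where
  V := Option A.V
  E := Option A.E
  inc := fun v => v.elim ![some A.root, none, none] (fun v i => some (A.inc v i))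

/-- The lattice points whose weighting vanishes on the root. -/
def rootZeroPoints (A : RootedGraph) : AddSubmonoid ((A.E → ℤ) × ℕ) where
  carrier := {p | p ∈ A.latticePoints ∧ p.1 A.root = 0}
  zero_mem' := ⟨zero_mem _, rfl⟩
  add_mem' := fun hp hq => ⟨add_mem hp.1 hq.1, by simp [hp.2, hq.2]⟩

end RootedGraph

/-- `IsRootedGamma g n A`: `A` is a graph `Γ(g, n)` with `n ≥ 1` leaves, one of them chosen as root.

* `g = 0` (built from `line` and `node`): all trivalent trees with `n ≥ 2` leaves.
* `n = 1` (built from `loop` and `bigon`): the graph `Γ(g, 1)`, a loop followed by a chain of `g - 1`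
  bigons, consecutive ones being joined by a single edge, ending in a leaf edge.
* In general, `Γ(g, 1)` with its leaf edge identified with a leaf edge of a trivalent tree with
  `n + 1` leaves. Seen from one of the other leaves, this is a sequence of vertices on the path to
  `Γ(g, 1)`, at each of which a rooted tree is attached. -/
inductive IsRootedGamma : ℕ → ℕ → RootedGraph → Prop
  | line : IsRootedGamma 0 2 RootedGraph.line
  | loop : IsRootedGamma 1 1 RootedGraph.loop
  | bigon {g : ℕ} {A : RootedGraph} :
      IsRootedGamma g 1 A → IsRootedGamma (g + 1) 1 A.bigon
  | node {g m n : ℕ} {A B : RootedGraph} :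
      IsRootedGamma 0 (m + 1) A → IsRootedGamma g n B → IsRootedGamma g (n + m) (A.node B)

/-- `IsGamma g n Γ`: `Γ` is a graph `Γ(g, n)`, where `2 g - 2 + n > 0`. For `n = 0` this is the chain
with `g - 2` bigons and a loop at both ends. -/
inductive IsGamma : ℕ → ℕ → TrivalentGraph → Prop
  | leaves {g n : ℕ} {A : RootedGraph} :
      IsRootedGamma g n A → 2 < 2 * g + n → IsGamma g n A.toTrivalentGraph
  | noLeaves {g : ℕ} {A : RootedGraph} :
      IsRootedGamma g 1 A → IsGamma (g + 1) 0 A.close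

section Presentation

variable {E : Type} (S : AddSubmonoid ((E → ℤ) × ℕ))

/-- The elements of level `1` and `2` of a semigroup of pairs (weighting, level). -/
abbrev LowLevel : Type := {p : S // p.1.2 = 1 ∨ p.1.2 = 2}

/-- The monomial of the semigroup algebra `ℂ[S]` given by an element of level `1` or `2`. -/
noncomputable def lowLevelMonomial (p : LowLevel S) : AddMonoidAlgebra ℂ S :=
  AddMonoidAlgebra.single p.1 1

/-- The algebra map from the polynomial ring with one variable for each element of level `1` or `2`
to `ℂ[S]`; its kernel is the ideal of relations. -/
noncomputable def presentation : MvPolynomial (LowLevel S) ℂ →ₐ[ℂ] AddMonoidAlgebra ℂ S :=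
  MvPolynomial.aeval (lowLevelMonomial S)

/-- `ℂ[S]` is generated by the elements of levels `1` and `2`. -/
def GeneratedInLevelsOneTwo : Prop :=
  Algebra.adjoin ℂ (Set.range (lowLevelMonomial S)) = ⊤

/-- The ideal of relations among the elements of levels `1` and `2` is generated by homogeneous
relations of degree at most `d`, where a variable has as its degree the level of its element. -/
def RelationsGeneratedInDegreeLE (d : ℕ) : Prop :=
  RingHom.ker (presentation S) =
    Ideal.span {f | f ∈ RingHom.ker (presentation S) ∧
      ∃ k ≤ d, MvPolynomial.IsWeightedHomogeneous (fun p : LowLevel S => p.1.1.2) f k}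

end Presentation

/-! The graph is cut along edges into single trivalent vertices and bigons, and factorizations into
elements of low level are glued back together. `Quad adm S` is the property that survives gluing:
every element of `S` has a factorization with levels allowed by `adm`, and any two of them are
joined by exchanges of two members for two others with the same levels and the same sum.

Gluing (`Quad.glue`) is a toric fiber product. The type of an element is its weight on the cut edge
together with its level. If the sum of an admissible multiset of types determines the multiset
(`TypeSystem`), then factorizations of the two halves always match up, and a move on one half lifts
while the other half stays fixed. This holds in two situations. Inside trees all levels are `1` and
the weights on the cut edge are `0` or `1` (`AdmOne`, `TypOne`). Along the chain of bigons parity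
forces the weights on the connecting edges to be even; there the levels are `2` with at most one
`1`, and the weights are `0`, or also `2` at level `2` (`AdmTwo`, `TypTwo`).

The local pieces are explicit: the semigroup of a vertex is free on its four elements of level `1`
(`quad_tripodPoints`), and the bigon has a normal form with respect to a few quadratic moves
(`quad_bigonPoints`). A single edge and a loop are faces of these. Before a tree is attached to a
chain it has to pass from level `1` to level `2`: by `Quad.evenPart`, elements of even root weight
factor into sums of two level-`1` elements with equal root weights.

A pair move involves two elements of level at most `2`, hence gives a relation of degree at most
`4`. Arbitrary products of elements of levels `1` and `2` reduce to admissible ones by splitting or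
merging, in degree at most `2` (`Quad.lowPresented_one`, `Quad.lowPresented_two`), and
`LowPresented.relations` turns connectedness into generation of the ideal. -/

open Relation

/-! ### Factorizations and pair moves -/

/-- Weightings of a set of edges together with a level. -/
abbrev Wt (E : Type) : Type := (E → ℤ) × ℕ

/-- Restriction of weightings along a map of edge sets. -/
def restrict {E E' : Type} (i : E' → E) : Wt E →+ Wt E' where
  toFun p := (p.1 ∘ i, p.2)
  map_zero' := rfl
  map_add' _ _ := rfl

@[simp] lemma restrict_fst {E E' : Type} (i : E' → E) (p : Wt E) (e : E') :
    (restrict i p).1 e = p.1 (i e) := rfl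

@[simp] lemma restrict_snd {E E' : Type} (i : E' → E) (p : Wt E) : (restrict i p).2 = p.2 := rfl

/-- A pair move: two members of a multiset are replaced by two elements of the same levels and with
the same sum. -/
def PairMove {E : Type} (S : AddSubmonoid (Wt E)) (F F' : Multiset (Wt E)) : Prop :=
  ∃ p q p' q' N, p ∈ S ∧ q ∈ S ∧ p' ∈ S ∧ q' ∈ S ∧ p + q = p' + q' ∧ p.2 = p'.2 ∧ q.2 = q'.2 ∧
    F = p ::ₘ q ::ₘ N ∧ F' = p' ::ₘ q' ::ₘ N

/-- Multisets of elements of `S` whose levels form an admissible multiset. -/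
def IsFactorization {E : Type} (adm : Multiset ℕ → Prop) (S : AddSubmonoid (Wt E))
    (F : Multiset (Wt E)) : Prop :=
  (∀ p ∈ F, p ∈ S) ∧ adm (F.map Prod.snd)

/-- Every element of `S` has an admissible factorization, and any two admissible factorizations
of the same element are connected by pair moves. -/
structure Quad {E : Type} (adm : Multiset ℕ → Prop) (S : AddSubmonoid (Wt E)) : Prop where
  gen : ∀ s ∈ S, ∃ F, IsFactorization adm S F ∧ F.sum = s
  conn : ∀ F F', IsFactorization adm S F → IsFactorization adm S F' → F.sum = F'.sum →
    ReflTransGen (PairMove S) F F'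

section PairMove

variable {E : Type} {S : AddSubmonoid (Wt E)} {F F' : Multiset (Wt E)}

lemma PairMove.mem (h : PairMove S F F') (hF : ∀ p ∈ F, p ∈ S) : ∀ p ∈ F', p ∈ S := by
  obtain ⟨p, q, p', q', N, hp, hq, hp', hq', -, -, -, rfl, rfl⟩ := h
  simp only [Multiset.mem_cons, forall_eq_or_imp] at hF ⊢
  exact ⟨hp', hq', hF.2.2⟩

lemma PairMove.map_snd (h : PairMove S F F') : F'.map Prod.snd = F.map Prod.snd := by
  obtain ⟨p, q, p', q', N, hp, hq, hp', hq', -, h1, h2, rfl, rfl⟩ := h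
  simp [h1, h2]

lemma PairMove.sum_eq (h : PairMove S F F') : F'.sum = F.sum := by
  obtain ⟨p, q, p', q', N, hp, hq, hp', hq', h, h1, h2, rfl, rfl⟩ := h
  simp only [Multiset.sum_cons, ← add_assoc, h]

lemma PairMove.symm (h : PairMove S F F') : PairMove S F' F := by
  obtain ⟨p, q, p', q', N, hp, hq, hp', hq', h, h1, h2, rfl, rfl⟩ := h
  exact ⟨p', q', p, q, N, hp', hq', hp, hq, h.symm, h1.symm, h2.symm, rfl, rfl⟩

lemma PairMove.cons (h : PairMove S F F') (x : Wt E) : PairMove S (x ::ₘ F) (x ::ₘ F') := by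
  obtain ⟨p, q, p', q', N, hp, hq, hp', hq', h, h1, h2, rfl, rfl⟩ := h
  refine ⟨p, q, p', q', x ::ₘ N, hp, hq, hp', hq', h, h1, h2, ?_, ?_⟩
  · rw [Multiset.cons_swap x p, Multiset.cons_swap x q]
  · rw [Multiset.cons_swap x p', Multiset.cons_swap x q']

lemma reflTransGen_symm (h : ReflTransGen (PairMove S) F F') : ReflTransGen (PairMove S) F' F :=
  haveI : Std.Symm (PairMove S) := ⟨fun _ _ h => h.symm⟩
  Std.Symm.symm (r := ReflTransGen (PairMove S)) _ _ h

lemma reflTransGen_cons (h : ReflTransGen (PairMove S) F F') (x : Wt E) :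
    ReflTransGen (PairMove S) (x ::ₘ F) (x ::ₘ F') :=
  h.lift (fun F => x ::ₘ F) fun _ _ h => h.cons x

lemma reflTransGen_mem (h : ReflTransGen (PairMove S) F F') (hF : ∀ p ∈ F, p ∈ S) :
    ∀ p ∈ F', p ∈ S := by
  induction h with
  | refl => exact hF
  | tail _ h ih => exact h.mem ih

lemma reflTransGen_map_snd (h : ReflTransGen (PairMove S) F F') :
    F'.map Prod.snd = F.map Prod.snd := by
  induction h with
  | refl => rfl
  | tail _ h ih => exact h.map_snd.trans ih

lemma reflTransGen_sum_eq (h : ReflTransGen (PairMove S) F F') : F'.sum = F.sum := by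
  induction h with
  | refl => rfl
  | tail _ h ih => exact h.sum_eq.trans ih

lemma reflTransGen_isFactorization {adm : Multiset ℕ → Prop} (h : ReflTransGen (PairMove S) F F')
    (hF : IsFactorization adm S F) : IsFactorization adm S F' :=
  ⟨reflTransGen_mem h hF.1, by rw [reflTransGen_map_snd h]; exact hF.2⟩

end PairMove

/-! ### Transfer and faces -/

lemma multiset_sum_snd {E : Type} (F : Multiset (Wt E)) :
    F.sum.2 = (F.map Prod.snd).sum :=
  map_multiset_sum (AddMonoidHom.snd (E → ℤ) ℕ) F

/-- `Quad` is transported along mutually inverse additive maps that preserve the level. -/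
lemma Quad.transfer {E E' : Type} {adm : Multiset ℕ → Prop} {S : AddSubmonoid (Wt E)}
    {S' : AddSubmonoid (Wt E')} (h : Quad adm S') (θ : Wt E →+ Wt E') (ψ : Wt E' →+ Wt E)
    (hθ : ∀ p ∈ S, θ p ∈ S') (hψ : ∀ p ∈ S', ψ p ∈ S) (hψθ : ∀ p ∈ S, ψ (θ p) = p)
    (lθ : ∀ p, (θ p).2 = p.2) (lψ : ∀ p, (ψ p).2 = p.2) : Quad adm S where
  gen s hs := by
    obtain ⟨F, hF, hFs⟩ := h.gen _ (hθ s hs)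
    refine ⟨F.map ψ, ⟨?_, ?_⟩, ?_⟩
    · simp only [Multiset.mem_map, forall_exists_index, and_imp, forall_apply_eq_imp_iff₂]
      exact fun p hp => hψ p (hF.1 p hp)
    · simpa [Multiset.map_map, lψ] using hF.2
    · rw [← map_multiset_sum, hFs, hψθ s hs]
  conn F F' hF hF' hs := by
    have key : ∀ F, IsFactorization adm S F → IsFactorization adm S' (F.map θ) := by
      intro F hF
      refine ⟨?_, by simpa [Multiset.map_map, lθ] using hF.2⟩
      simp only [Multiset.mem_map, forall_exists_index, and_imp, forall_apply_eq_imp_iff₂]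
      exact fun p hp => hθ p (hF.1 p hp)
    have back : ∀ F, IsFactorization adm S F → (F.map θ).map ψ = F := by
      intro F hF
      rw [Multiset.map_map]
      exact (Multiset.map_congr rfl fun p hp => hψθ p (hF.1 p hp)).trans (Multiset.map_id' F)
    have := h.conn _ _ (key F hF) (key F' hF') (by
      rw [← map_multiset_sum, ← map_multiset_sum, hs])
    rw [← back F hF, ← back F' hF']
    refine this.lift (Multiset.map ψ) ?_
    rintro _ _ ⟨p, q, p', q', N, hp, hq, hp', hq', h, h1, h2, rfl, rfl⟩
    exact ⟨ψ p, ψ q, ψ p', ψ q', N.map ψ, hψ _ hp, hψ _ hq, hψ _ hp', hψ _ hq',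
      by rw [← map_add, h, map_add], by rw [lψ, lψ, h1], by rw [lψ, lψ, h2], by simp, by simp⟩

/-- The face of `S` on which a coordinate vanishes. -/
def face {E : Type} (S : AddSubmonoid (Wt E)) (e : E) : AddSubmonoid (Wt E) where
  carrier := {p | p ∈ S ∧ p.1 e = 0}
  zero_mem' := ⟨zero_mem _, rfl⟩
  add_mem' := fun hp hq => ⟨add_mem hp.1 hq.1, by simp [hp.2, hq.2]⟩

lemma mem_face_of_sum {E : Type} {S : AddSubmonoid (Wt E)} {e : E} (hS : ∀ p ∈ S, 0 ≤ p.1 e)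
    {F : Multiset (Wt E)} (hF : ∀ p ∈ F, p ∈ S) (h : F.sum.1 e = 0) : ∀ p ∈ F, p ∈ face S e := by
  induction F using Multiset.induction_on with
  | empty => simp
  | cons a F ih =>
    simp only [Multiset.mem_cons, forall_eq_or_imp] at hF ⊢
    have h0 : 0 ≤ F.sum.1 e := hS _ (AddSubmonoid.multiset_sum_mem _ _ hF.2)
    have h1 := hS a hF.1
    have h2 : a.1 e + F.sum.1 e = 0 := by simpa using h
    exact ⟨⟨hF.1, by linarith⟩, ih hF.2 (by linarith)⟩

/-- Non-negative weights with sum zero all vanish, so every factorization of an element of the face,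
and every move between such factorizations, stays inside the face. -/
lemma Quad.face {E : Type} {adm : Multiset ℕ → Prop} {S : AddSubmonoid (Wt E)} (h : Quad adm S)
    (e : E) (hS : ∀ p ∈ S, 0 ≤ p.1 e) : Quad adm (face S e) where
  gen s hs := by
    obtain ⟨F, hF, hFs⟩ := h.gen s hs.1
    exact ⟨F, ⟨mem_face_of_sum hS hF.1 (hFs ▸ hs.2), hF.2⟩, hFs⟩
  conn F F' hF hF' hs := by
    have hr := h.conn F F' ⟨fun p hp => (hF.1 p hp).1, hF.2⟩
      ⟨fun p hp => (hF'.1 p hp).1, hF'.2⟩ hs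
    clear hs hF'
    induction hr with
    | refl => rfl
    | @tail G G' _ hm ih =>
      refine ih.tail ?_
      have hG := reflTransGen_mem ih hF.1
      obtain ⟨p, q, p', q', N, hp, hq, hp', hq', h, h1, h2, rfl, rfl⟩ := hm
      simp only [Multiset.mem_cons, forall_eq_or_imp] at hG
      have hz : ({p', q'} : Multiset (Wt E)).sum.1 e = 0 := by
        have : (p' + q').1 e = 0 := by rw [← h]; simp [hG.1.2, hG.2.1.2]
        simpa using this
      have := mem_face_of_sum (F := {p', q'}) hS (by simp [hp', hq']) hz
      simp only [Multiset.insert_eq_cons, Multiset.mem_cons, Multiset.mem_singleton,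
        forall_eq_or_imp, forall_eq] at this
      exact ⟨p, q, p', q', N, hG.1, hG.2.1, this.1, this.2, h, h1, h2, rfl, rfl⟩

/-! ### Gluing along an edge -/

/-- The edge set `E` is obtained from `E₁` and `E₂` by identifying `a` with `b`. -/
structure Glue {E₁ E₂ E : Type} (i : E₁ → E) (j : E₂ → E) (a : E₁) (b : E₂) : Prop where
  comm : i a = j b
  exists_glue : ∀ (x : E₁ → ℤ) (y : E₂ → ℤ), x a = y b → ∃ z : E → ℤ, z ∘ i = x ∧ z ∘ j = y
  cover : ∀ e, (∃ x, i x = e) ∨ ∃ y, j y = e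

namespace Glue

variable {E₁ E₂ E : Type} {i : E₁ → E} {j : E₂ → E} {a : E₁} {b : E₂}

lemma symm (h : Glue i j a b) : Glue j i b a where
  comm := h.comm.symm
  exists_glue x y hxy := (h.exists_glue y x hxy.symm).imp fun _ h => h.symm
  cover e := (h.cover e).symm

lemma ext (h : Glue i j a b) {z z' : Wt E} (h1 : restrict i z = restrict i z')
    (h2 : restrict j z = restrict j z') : z = z' := by
  refine Prod.ext (funext fun e => ?_) (congrArg Prod.snd h1 :)
  rcases h.cover e with ⟨x, rfl⟩ | ⟨y, rfl⟩
  · exact congrFun (congrArg Prod.fst h1) x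
  · exact congrFun (congrArg Prod.fst h2) y

lemma exists_wt (h : Glue i j a b) (x : Wt E₁) (y : Wt E₂) (h1 : x.1 a = y.1 b)
    (h2 : x.2 = y.2) : ∃ z : Wt E, restrict i z = x ∧ restrict j z = y := by
  obtain ⟨z, hz, hz'⟩ := h.exists_glue x.1 y.1 h1
  exact ⟨(z, x.2), Prod.ext hz rfl, Prod.ext hz' h2⟩

end Glue

/-- A pair of conditions on admissible level multisets and types, where the type of an element is its
weight on a given edge together with its level: an admissible multiset of types is determined by
its sum. -/
structure TypeSystem (adm : Multiset ℕ → Prop) (typ : ℤ × ℕ → Prop) : Prop where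
  mono : ∀ m m', m' ≤ m → adm m → adm m'
  inj : ∀ t t' : Multiset (ℤ × ℕ), adm (t.map Prod.snd) → adm (t'.map Prod.snd) →
    (∀ x ∈ t, typ x) → (∀ x ∈ t', typ x) → t.sum = t'.sum → t = t'

/-- The type of a weighting with respect to an edge. -/
def typeAt {E : Type} (e : E) : Wt E →+ ℤ × ℕ where
  toFun p := (p.1 e, p.2)
  map_zero' := rfl
  map_add' _ _ := rfl

lemma typeAt_apply {E : Type} (e : E) (p : Wt E) : typeAt e p = (p.1 e, p.2) := rfl

lemma map_snd_typeAt {E : Type} (e : E) (F : Multiset (Wt E)) :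
    (F.map (typeAt e)).map Prod.snd = F.map Prod.snd := by
  rw [Multiset.map_map]; rfl

lemma exists_cons_of_map_eq_cons {α β : Type*} {f : α → β} {s : Multiset α} {t : Multiset β}
    {b : β} (h : s.map f = b ::ₘ t) : ∃ a s', s = a ::ₘ s' ∧ f a = b ∧ s'.map f = t := by
  classical
  obtain ⟨a, ha, hab, ht⟩ := (Multiset.map_eq_cons f s t b).2 h
  exact ⟨a, s.erase a, (Multiset.cons_erase ha).symm, hab, ht⟩

lemma exists_pairs_of_map_eq {α β γ : Type*} (f : α → γ) (g : β → γ) (s : Multiset α) :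
    ∀ t : Multiset β, s.map f = t.map g →
      ∃ H : Multiset (α × β), H.map Prod.fst = s ∧ H.map Prod.snd = t ∧ ∀ h ∈ H, f h.1 = g h.2 := by
  induction s using Multiset.induction_on with
  | empty =>
    intro t ht
    have : t = 0 := by simpa using ht.symm
    exact ⟨0, by simp [this]⟩
  | cons x s ih =>
    intro t ht
    rw [Multiset.map_cons] at ht
    obtain ⟨y, t', rfl, hxy, hr⟩ := exists_cons_of_map_eq_cons ht.symm
    obtain ⟨H, rfl, rfl, hH⟩ := ih t' hr.symm
    exact ⟨(x, y) ::ₘ H, by simp, by simp, by simpa [hxy] using hH⟩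

lemma pair_eq_pair {α : Type*} {x y x' y' : α} (h : ({x, y} : Multiset α) = {x', y'}) :
    (x = x' ∧ y = y') ∨ (x = y' ∧ y = x') := by
  rw [Multiset.insert_eq_cons, Multiset.insert_eq_cons, Multiset.cons_eq_cons] at h
  rcases h with ⟨h1, h2⟩ | ⟨-, c, h1, h2⟩
  · exact Or.inl ⟨h1, by simpa using h2⟩
  · have h1' := (Multiset.singleton_eq_cons_iff _).1 h1
    have h2' := (Multiset.singleton_eq_cons_iff _).1 h2
    exact Or.inr ⟨h2'.1.symm, h1'.1⟩

section Fiber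

variable {E₁ E₂ E : Type} {i : E₁ → E} {j : E₂ → E} {a : E₁} {b : E₂}
  {adm : Multiset ℕ → Prop} {typ : ℤ × ℕ → Prop}
  {S₁ : AddSubmonoid (Wt E₁)} {S₂ : AddSubmonoid (Wt E₂)} {Z : AddSubmonoid (Wt E)}

lemma Glue.typeAt_eq (g : Glue i j a b) (z : Wt E) :
    typeAt a (restrict i z) = typeAt b (restrict j z) := by
  simp [typeAt_apply, g.comm]

/-- A pair move of the restrictions to one side of a gluing lifts. -/
lemma Glue.lift_pairMove (g : Glue i j a b) (T : TypeSystem adm typ)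
    (h₁ : ∀ p ∈ S₁, adm {p.2} → typ (typeAt a p))
    (hZ : ∀ p, p ∈ Z ↔ restrict i p ∈ S₁ ∧ restrict j p ∈ S₂)
    {G : Multiset (Wt E)} (hG : IsFactorization adm Z G) {B : Multiset (Wt E₁)}
    (h : PairMove S₁ (G.map (restrict i)) B) :
    ∃ G', PairMove Z G G' ∧ G'.map (restrict i) = B ∧
      G'.map (restrict j) = G.map (restrict j) := by
  obtain ⟨p, q, p', q', N, hp, hq, hp', hq', hs, hl, hl', hGN, rfl⟩ := h
  obtain ⟨z, G, rfl, rfl, hGN'⟩ := exists_cons_of_map_eq_cons hGN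
  obtain ⟨w, N, rfl, rfl, rfl⟩ := exists_cons_of_map_eq_cons hGN'
  have hadm : adm {z.2, w.2} := T.mono _ _ (by
    simp only [Multiset.map_cons, Multiset.insert_eq_cons]
    exact Multiset.cons_le_cons _ (Multiset.cons_le_cons _ (Multiset.zero_le _))) hG.2
  have hz : z ∈ Z := hG.1 z (by simp)
  have hw : w ∈ Z := hG.1 w (by simp)
  have adm1 : adm {z.2} := T.mono _ _ (by simp) hadm
  have adm2 : adm {w.2} := T.mono _ _ (by simp [Multiset.insert_eq_cons]) hadm
  simp only [restrict_snd] at hl hl'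
  -- A pair move preserves the sum, hence by `T.inj` the two types at the cut edge up to order. The
  -- new elements therefore still fit the unchanged halves on the other side.
  have key : ({typeAt a (restrict i z), typeAt a (restrict i w)} : Multiset (ℤ × ℕ)) =
      {typeAt a p', typeAt a q'} := by
    refine T.inj _ _ ?_ ?_ ?_ ?_ ?_
    · simpa [typeAt_apply, Multiset.insert_eq_cons] using hadm
    · simpa [typeAt_apply, ← hl, ← hl', Multiset.insert_eq_cons] using hadm
    · simp only [Multiset.insert_eq_cons, Multiset.mem_cons, Multiset.mem_singleton,
        forall_eq_or_imp, forall_eq]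
      exact ⟨h₁ _ hp adm1, h₁ _ hq adm2⟩
    · simp only [Multiset.insert_eq_cons, Multiset.mem_cons, Multiset.mem_singleton,
        forall_eq_or_imp, forall_eq]
      exact ⟨h₁ _ hp' (hl ▸ adm1), h₁ _ hq' (hl' ▸ adm2)⟩
    · simp only [Multiset.insert_eq_cons, Multiset.sum_cons, Multiset.sum_singleton, ← map_add, hs]
  have main : ∀ r s, r ∈ S₁ → s ∈ S₁ → restrict i z + restrict i w = r + s →
      typeAt a (restrict i z) = typeAt a r → typeAt a (restrict i w) = typeAt a s →
      ∃ G', PairMove Z (z ::ₘ w ::ₘ N) G' ∧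
        G'.map (restrict i) = r ::ₘ s ::ₘ N.map (restrict i) ∧
        G'.map (restrict j) = (z ::ₘ w ::ₘ N).map (restrict j) := by
    intro r s hr hs' hrs h1 h2
    rw [g.typeAt_eq] at h1 h2
    simp only [typeAt_apply, Prod.mk.injEq] at h1 h2
    obtain ⟨z', hz1, hz2⟩ := g.exists_wt r (restrict j z) h1.1.symm h1.2.symm
    obtain ⟨w', hw1, hw2⟩ := g.exists_wt s (restrict j w) h2.1.symm h2.2.symm
    refine ⟨z' ::ₘ w' ::ₘ N, ⟨z, w, z', w', N, hz, hw, ?_, ?_, ?_, ?_, ?_, rfl, rfl⟩, ?_, ?_⟩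
    · rw [hZ, hz1, hz2]; exact ⟨hr, ((hZ z).1 hz).2⟩
    · rw [hZ, hw1, hw2]; exact ⟨hs', ((hZ w).1 hw).2⟩
    · refine g.ext ?_ ?_
      · rw [map_add, map_add, hz1, hw1, hrs]
      · rw [map_add, map_add, hz2, hw2]
    · exact (congrArg Prod.snd hz2 :).symm
    · exact (congrArg Prod.snd hw2 :).symm
    · simp [hz1, hw1]
    · simp [hz2, hw2]
  rcases pair_eq_pair key with ⟨h1, h2⟩ | ⟨h1, h2⟩
  · exact main p' q' hp' hq' hs h1 h2
  · obtain ⟨G', hG1, hG2, hG3⟩ := main q' p' hq' hp' (by rw [hs, add_comm]) h1 h2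
    exact ⟨G', hG1, by rw [hG2, Multiset.cons_swap], hG3⟩

lemma Glue.lift_reflTransGen (g : Glue i j a b) (T : TypeSystem adm typ)
    (h₁ : ∀ p ∈ S₁, adm {p.2} → typ (typeAt a p))
    (hZ : ∀ p, p ∈ Z ↔ restrict i p ∈ S₁ ∧ restrict j p ∈ S₂)
    {G : Multiset (Wt E)} (hG : IsFactorization adm Z G) {B : Multiset (Wt E₁)}
    (h : ReflTransGen (PairMove S₁) (G.map (restrict i)) B) :
    ∃ G', ReflTransGen (PairMove Z) G G' ∧ G'.map (restrict i) = B ∧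
      G'.map (restrict j) = G.map (restrict j) := by
  induction h with
  | refl => exact ⟨G, ReflTransGen.refl, rfl, rfl⟩
  | tail _ hm ih =>
    obtain ⟨G₁, h1, rfl, h3⟩ := ih
    obtain ⟨G₂, h4, h5, h6⟩ := g.lift_pairMove T h₁ hZ (reflTransGen_isFactorization h1 hG) hm
    exact ⟨G₂, h1.tail h4, h5, h6.trans h3⟩

/-- Factorizations with the same restrictions to both sides of a gluing are connected. -/
lemma Glue.connected_of_map_eq (g : Glue i j a b)
    (hZ : ∀ p, p ∈ Z ↔ restrict i p ∈ S₁ ∧ restrict j p ∈ S₂) (G : Multiset (Wt E)) :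
    ∀ G' : Multiset (Wt E), (∀ p ∈ G, p ∈ Z) → (∀ p ∈ G', p ∈ Z) →
      G'.map (restrict i) = G.map (restrict i) → G'.map (restrict j) = G.map (restrict j) →
      ReflTransGen (PairMove Z) G' G := by
  induction G using Multiset.induction_on with
  | empty =>
    intro G' _ _ h _
    have : G' = 0 := by simpa using h
    rw [this]
  | cons z G ih =>
    intro G' hG hG' h1 h2
    rw [Multiset.map_cons] at h1 h2
    obtain ⟨z₁, N, rfl, hz1, h1'⟩ := exists_cons_of_map_eq_cons h1
    obtain ⟨z₂, N', hN', hz2, h2'⟩ := exists_cons_of_map_eq_cons h2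
    simp only [Multiset.mem_cons, forall_eq_or_imp] at hG hG'
    rw [Multiset.cons_eq_cons] at hN'
    rcases hN' with ⟨rfl, rfl⟩ | ⟨-, N', rfl, rfl⟩
    · obtain rfl := g.ext hz1 hz2
      exact reflTransGen_cons (ih N hG.2 hG'.2 h1' h2') _
    · simp only [Multiset.mem_cons, forall_eq_or_imp] at hG'
      have e1 := congrArg (typeAt a) hz1
      have e2 := congrArg (typeAt b) hz2
      rw [g.typeAt_eq] at e1
      rw [← g.typeAt_eq, ← g.typeAt_eq, ← e1] at e2
      simp only [typeAt_apply, Prod.mk.injEq] at e1 e2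
      -- `z₁` has the left half of `z` and `z₂` its right half. All these types at the cut edge
      -- agree, so exchanging the right halves of `z₁` and `z₂` yields `z` and the complementary
      -- element `w`.
      obtain ⟨w, hw1, hw2⟩ := g.exists_wt (restrict i z₂) (restrict j z₁) e2.1 e2.2
      have hw : w ∈ Z := by
        rw [hZ, hw1, hw2]
        exact ⟨((hZ _).1 hG'.2.1).1, ((hZ _).1 hG'.1).2⟩
      have hm : PairMove Z (z₁ ::ₘ z₂ ::ₘ N') (z ::ₘ w ::ₘ N') := by
        refine ⟨z₁, z₂, z, w, N', hG'.1, hG'.2.1, hG.1, hw, g.ext ?_ ?_, ?_, ?_, rfl, rfl⟩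
        · rw [map_add, map_add, hz1, hw1]
        · rw [map_add, map_add, hz2, hw2, add_comm]
        · exact (congrArg Prod.snd hz1 :)
        · exact (congrArg Prod.snd hw1 :).symm
      refine ReflTransGen.head hm (reflTransGen_cons (ih _ hG.2 ?_ ?_ ?_) _)
      · simpa [hw] using hG'.2.2
      · rw [← h1']; simp [hw1]
      · rw [← h2']; simp [hw2]

/-- Gluing along an edge preserves quadratic presentability. -/
theorem Quad.glue (H₁ : Quad adm S₁) (H₂ : Quad adm S₂) (g : Glue i j a b)
    (T : TypeSystem adm typ) (h₁ : ∀ p ∈ S₁, adm {p.2} → typ (typeAt a p))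
    (h₂ : ∀ p ∈ S₂, adm {p.2} → typ (typeAt b p))
    (hZ : ∀ p, p ∈ Z ↔ restrict i p ∈ S₁ ∧ restrict j p ∈ S₂) : Quad adm Z where
  gen z hz := by
    obtain ⟨hz1, hz2⟩ := (hZ z).1 hz
    obtain ⟨F₁, hF₁, hs₁⟩ := H₁.gen _ hz1
    obtain ⟨F₂, hF₂, hs₂⟩ := H₂.gen _ hz2
    have single : ∀ {m : Multiset ℕ} {l}, adm m → l ∈ m → adm {l} := fun hm hl =>
      T.mono _ _ (by simpa using hl) hm
    -- The two sides have the same sum of types, hence the same types, and can be matched member by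
    -- member.
    have key : F₁.map (typeAt a) = F₂.map (typeAt b) := by
      refine T.inj _ _ ?_ ?_ ?_ ?_ ?_
      · rw [map_snd_typeAt]; exact hF₁.2
      · rw [map_snd_typeAt]; exact hF₂.2
      · simp only [Multiset.mem_map, forall_exists_index, and_imp, forall_apply_eq_imp_iff₂]
        exact fun p hp => h₁ p (hF₁.1 p hp) (single hF₁.2 (Multiset.mem_map_of_mem _ hp))
      · simp only [Multiset.mem_map, forall_exists_index, and_imp, forall_apply_eq_imp_iff₂]
        exact fun p hp => h₂ p (hF₂.1 p hp) (single hF₂.2 (Multiset.mem_map_of_mem _ hp))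
      · rw [← map_multiset_sum, ← map_multiset_sum, hs₁, hs₂, g.typeAt_eq]
    obtain ⟨H, rfl, rfl, hH⟩ := exists_pairs_of_map_eq _ _ _ _ key
    have hex : ∀ h : Wt E₁ × Wt E₂, ∃ z : Wt E, typeAt a h.1 = typeAt b h.2 →
        restrict i z = h.1 ∧ restrict j z = h.2 := by
      intro h
      by_cases hh : typeAt a h.1 = typeAt b h.2
      · obtain ⟨z, hz⟩ := g.exists_wt h.1 h.2 (congrArg Prod.fst hh :) (congrArg Prod.snd hh :)
        exact ⟨z, fun _ => hz⟩
      -- A default value for pairs that do not fit; no such pair occurs in `H`.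
      · exact ⟨0, fun h => absurd h hh⟩
    choose gl hgl using hex
    have e1 : (H.map gl).map (restrict i) = H.map Prod.fst := by
      rw [Multiset.map_map]
      exact Multiset.map_congr rfl fun h hh => (hgl h (hH h hh)).1
    have e2 : (H.map gl).map (restrict j) = H.map Prod.snd := by
      rw [Multiset.map_map]
      exact Multiset.map_congr rfl fun h hh => (hgl h (hH h hh)).2
    refine ⟨H.map gl, ⟨?_, ?_⟩, g.ext ?_ ?_⟩
    · simp only [Multiset.mem_map, forall_exists_index, and_imp, forall_apply_eq_imp_iff₂]
      intro h hh
      rw [hZ, (hgl h (hH h hh)).1, (hgl h (hH h hh)).2]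
      exact ⟨hF₁.1 _ (Multiset.mem_map_of_mem _ hh), hF₂.1 _ (Multiset.mem_map_of_mem _ hh)⟩
    · have := hF₁.2
      rw [← e1, Multiset.map_map] at this
      exact this
    · rw [map_multiset_sum, e1, hs₁]
    · rw [map_multiset_sum, e2, hs₂]
  conn F F' hF hF' hs := by
    have f1 : ∀ F, IsFactorization adm Z F → IsFactorization adm S₁ (F.map (restrict i)) := by
      intro F hF
      refine ⟨?_, by rw [Multiset.map_map]; exact hF.2⟩
      simp only [Multiset.mem_map, forall_exists_index, and_imp, forall_apply_eq_imp_iff₂]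
      exact fun p hp => ((hZ p).1 (hF.1 p hp)).1
    have f2 : ∀ F, IsFactorization adm Z F → IsFactorization adm S₂ (F.map (restrict j)) := by
      intro F hF
      refine ⟨?_, by rw [Multiset.map_map]; exact hF.2⟩
      simp only [Multiset.mem_map, forall_exists_index, and_imp, forall_apply_eq_imp_iff₂]
      exact fun p hp => ((hZ p).1 (hF.1 p hp)).2
    -- The left halves are corrected with the right halves fixed, then the right halves with the
    -- left fixed; what remains is a different matching of the same halves.
    obtain ⟨G, hG1, hG2, hG3⟩ := g.lift_reflTransGen T h₁ hZ hF
      (H₁.conn _ _ (f1 F hF) (f1 F' hF') (by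
        rw [← map_multiset_sum, ← map_multiset_sum, hs]))
    have hGf := reflTransGen_isFactorization hG1 hF
    obtain ⟨G', hG1', hG2', hG3'⟩ := g.symm.lift_reflTransGen T h₂
      (fun p => (hZ p).trans and_comm) hGf
      (H₂.conn _ _ (f2 G hGf) (f2 F' hF') (by
        rw [← map_multiset_sum, ← map_multiset_sum, reflTransGen_sum_eq hG1, hs]))
    have hGf' := reflTransGen_isFactorization hG1' hGf
    exact (hG1.trans hG1').trans
      (g.connected_of_map_eq hZ F' G' hF'.1 hGf'.1 (hG3'.trans hG2) hG2')

end Fiber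

/-! ### The two kinds of admissible levels -/

/-- All levels are `1`. -/
def AdmOne (m : Multiset ℕ) : Prop := ∀ l ∈ m, l = 1

/-- All levels are `1` or `2`, and level `1` occurs at most once. -/
def AdmTwo (m : Multiset ℕ) : Prop := (∀ l ∈ m, l = 1 ∨ l = 2) ∧ m.count 1 ≤ 1

/-- At level `1`, the weight is `0` or `1`. -/
def TypOne (x : ℤ × ℕ) : Prop := x.2 = 1 → x.1 = 0 ∨ x.1 = 1

/-- At level `1`, the weight is `0`, and at level `2`, it is `0` or `2`. -/
def TypTwo (x : ℤ × ℕ) : Prop := (x.2 = 1 → x.1 = 0) ∧ (x.2 = 2 → x.1 = 0 ∨ x.1 = 2)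

lemma multiset_eq_of_count {α : Type*} [DecidableEq α] {s : Finset α} {t t' : Multiset α}
    (h : ∀ x ∈ t, x ∈ s) (h' : ∀ x ∈ t', x ∈ s) (hc : ∀ x ∈ s, t.count x = t'.count x) :
    t = t' := by
  ext x
  by_cases hx : x ∈ s
  · exact hc x hx
  · rw [Multiset.count_eq_zero.2 fun hx' => hx (h x hx'),
      Multiset.count_eq_zero.2 fun hx' => hx (h' x hx')]

lemma multiset_sum_eq_count {α : Type*} [DecidableEq α] [AddCommMonoid α] {s : Finset α}
    {t : Multiset α} (h : ∀ x ∈ t, x ∈ s) : t.sum = ∑ x ∈ s, t.count x • x :=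
  Finset.sum_multiset_count_of_subset t s fun x hx => h x (Multiset.mem_toFinset.1 hx)

/-- The possible types `(0, 1)` and `(1, 1)` are linearly independent, so their multiplicities can
be read off from the sum. -/
lemma typeSystem_one : TypeSystem AdmOne TypOne where
  mono m m' hm h l hl := h l (Multiset.mem_of_le hm hl)
  inj := by
    have key : ∀ t : Multiset (ℤ × ℕ), AdmOne (t.map Prod.snd) → (∀ x ∈ t, TypOne x) →
        ∀ x ∈ t, x ∈ ({(0, 1), (1, 1)} : Finset (ℤ × ℕ)) := by
      rintro t ht ht' ⟨x, l⟩ hx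
      obtain rfl : l = 1 := ht l (Multiset.mem_map_of_mem Prod.snd hx)
      have := ht' _ hx rfl
      simpa using this
    intro t t' ht ht' h h' hs
    have k := key t ht h
    have k' := key t' ht' h'
    rw [multiset_sum_eq_count k, multiset_sum_eq_count k'] at hs
    simp [Prod.ext_iff] at hs
    refine multiset_eq_of_count k k' ?_
    simp only [Finset.mem_insert, Finset.mem_singleton, forall_eq_or_imp, forall_eq]
    omega

/-- The possible types are `(0, 1)`, `(0, 2)` and `(2, 2)`. The total weight gives the multiplicity
of `(2, 2)`; that of `(0, 1)` is at most one and is the parity of the total level; the rest is `(0,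
2)`. -/
lemma typeSystem_two : TypeSystem AdmTwo TypTwo where
  mono m m' hm h := ⟨fun l hl => h.1 l (Multiset.mem_of_le hm hl),
    (Multiset.count_le_of_le _ hm).trans h.2⟩
  inj := by
    have key : ∀ t : Multiset (ℤ × ℕ), AdmTwo (t.map Prod.snd) → (∀ x ∈ t, TypTwo x) →
        ∀ x ∈ t, x ∈ ({(0, 1), (0, 2), (2, 2)} : Finset (ℤ × ℕ)) := by
      rintro t ht ht' ⟨x, l⟩ hx
      have h1 := ht' _ hx
      rcases ht.1 l (Multiset.mem_map_of_mem Prod.snd hx) with rfl | rfl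
      · simpa using h1.1
      · simpa using h1.2
    have key' : ∀ t : Multiset (ℤ × ℕ), AdmTwo (t.map Prod.snd) → t.count (0, 1) ≤ 1 := by
      intro t ht
      refine le_trans ?_ ht.2
      rw [Multiset.le_count_iff_replicate_le, 
        ← Multiset.map_replicate Prod.snd _ ((0, 1) : ℤ × ℕ)]
      exact Multiset.map_le_map (Multiset.le_count_iff_replicate_le.1 le_rfl)
    intro t t' ht ht' h h' hs
    have k := key t ht h
    have k' := key t' ht' h'
    have c := key' t ht
    have c' := key' t' ht'
    rw [multiset_sum_eq_count k, multiset_sum_eq_count k'] at hs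
    simp [Prod.ext_iff] at hs
    refine multiset_eq_of_count k k' ?_
    simp only [Finset.mem_insert, Finset.mem_singleton, forall_eq_or_imp, forall_eq]
    omega

/-! ### The elements with even weight on an edge -/

/-- The elements of `S` with even weight on the edge `e`. -/
def evenPart {E : Type} (S : AddSubmonoid (Wt E)) (e : E) : AddSubmonoid (Wt E) where
  carrier := {p | p ∈ S ∧ Even (p.1 e)}
  zero_mem' := ⟨zero_mem _, by simp⟩
  add_mem' := fun hp hq => ⟨add_mem hp.1 hq.1, by simpa using hp.2.add hq.2⟩

lemma mem_evenPart {E : Type} {S : AddSubmonoid (Wt E)} {e : E} {p : Wt E} :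
    p ∈ evenPart S e ↔ p ∈ S ∧ Even (p.1 e) := Iff.rfl

/-- `Pairing e G F`: the members of `G` are the sums of pairs that partition `F`, where the two
elements of a pair have the same weight on the edge `e`. -/
inductive Pairing {E : Type} (e : E) : Multiset (Wt E) → Multiset (Wt E) → Prop
  | nil : Pairing e 0 0
  | cons {G F : Multiset (Wt E)} (p q : Wt E) : p.1 e = q.1 e → Pairing e G F →
      Pairing e ((p + q) ::ₘ G) (p ::ₘ q ::ₘ F)

section Pairing

variable {E : Type} {e : E} {S : AddSubmonoid (Wt E)} {F G : Multiset (Wt E)}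

lemma Pairing.sum_eq (h : Pairing e G F) : G.sum = F.sum := by
  induction h with
  | nil => rfl
  | cons p q _ _ ih => simp [ih, add_assoc]

lemma Pairing.eq_zero (h : Pairing e G F) (hF : F = 0) : G = 0 := by
  cases h with
  | nil => rfl
  | cons p q _ _ => simp at hF

lemma Pairing.even_card (h : Pairing e G F) : Even F.card := by
  induction h with
  | nil => simp
  | cons p q _ _ ih => simpa [add_assoc] using ih.add (by decide : Even 2)

lemma Pairing.mem (h : Pairing e G F) (hF : ∀ p ∈ F, p ∈ S) : ∀ p ∈ G, p ∈ evenPart S e := by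
  induction h with
  | nil => simp
  | cons p q hpq _ ih =>
    simp only [Multiset.mem_cons, forall_eq_or_imp] at hF ⊢
    exact ⟨⟨add_mem hF.1 hF.2.1, by simp [hpq]⟩, ih hF.2.2⟩

lemma Pairing.exists_partner (h : Pairing e G F) {p : Wt E} (hp : p ∈ F) :
    ∃ q G' F', G = (p + q) ::ₘ G' ∧ F = p ::ₘ q ::ₘ F' ∧ p.1 e = q.1 e ∧ Pairing e G' F' := by
  induction h with
  | nil => simp at hp
  | @cons G F x y hxy h ih =>
    simp only [Multiset.mem_cons] at hp
    rcases hp with rfl | rfl | hp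
    · exact ⟨y, G, F, rfl, rfl, hxy, h⟩
    · exact ⟨x, G, F, by rw [add_comm], Multiset.cons_swap _ _ _, hxy.symm, h⟩
    · obtain ⟨q, G', F', rfl, rfl, hq, h'⟩ := ih hp
      refine ⟨q, (x + y) ::ₘ G', x ::ₘ y ::ₘ F', Multiset.cons_swap _ _ _, ?_, hq, h'.cons x y hxy⟩
      rw [Multiset.cons_swap y p, Multiset.cons_swap x p, Multiset.cons_swap y q,
        Multiset.cons_swap x q]

lemma Pairing.cases_pair {N : Multiset (Wt E)} {p q : Wt E} (h : Pairing e G (p ::ₘ q ::ₘ N)) :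
    (p.1 e = q.1 e ∧ ∃ G', G = (p + q) ::ₘ G' ∧ Pairing e G' N) ∨
    ∃ a b G' N', p.1 e = a.1 e ∧ q.1 e = b.1 e ∧ G = (p + a) ::ₘ (q + b) ::ₘ G' ∧
      N = a ::ₘ b ::ₘ N' ∧ Pairing e G' N' := by
  obtain ⟨a, G', F', rfl, hF, hpa, h'⟩ := h.exists_partner (Multiset.mem_cons_self _ _)
  rw [Multiset.cons_inj_right, Multiset.cons_eq_cons] at hF
  rcases hF with ⟨rfl, rfl⟩ | ⟨-, F'', rfl, rfl⟩
  · exact Or.inl ⟨hpa, G', rfl, h'⟩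
  · obtain ⟨b, G'', N', rfl, hF, hqb, h''⟩ := h'.exists_partner (Multiset.mem_cons_self _ _)
    rw [Multiset.cons_inj_right] at hF
    subst hF
    exact Or.inr ⟨a, b, G'', N', hpa, hqb, rfl, rfl, h''⟩

/-- The multisets of elements of level `1` or `0` where level `0` occurs at most once. -/
def Padded (F : Multiset (Wt E)) : Prop :=
  (∀ p ∈ F, p.2 = 1 ∨ p.2 = 0) ∧ (F.map Prod.snd).count 0 ≤ 1

lemma Padded.of_cons {p : Wt E} (h : Padded (p ::ₘ F)) : Padded F := by
  refine ⟨fun q hq => h.1 q (Multiset.mem_cons_of_mem hq), le_trans ?_ h.2⟩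
  rw [Multiset.map_cons]
  exact Multiset.count_le_of_le _ (Multiset.le_cons_self _ _)

/-- Two ways to pair the same multiset are connected by pair moves. -/
lemma Pairing.connected {G G' : Multiset (Wt E)} (h : Pairing e G F) (h' : Pairing e G' F)
    (hF : ∀ p ∈ F, p ∈ S) (hP : Padded F) : ReflTransGen (PairMove (evenPart S e)) G' G := by
  induction h generalizing G' with
  | nil =>
    rw [h'.eq_zero rfl]
  | @cons G F p q hpq h ih =>
    have hF' := hF
    simp only [Multiset.mem_cons, forall_eq_or_imp] at hF
    rcases h'.cases_pair with ⟨-, G'', rfl, h''⟩ | ⟨a, b, G'', N', hpa, hqb, rfl, rfl, h''⟩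
    · exact reflTransGen_cons (ih h'' hF.2.2 hP.of_cons.of_cons) _
    · simp only [Multiset.mem_cons, forall_eq_or_imp] at hF
      have hab : a.1 e = b.1 e := by rw [← hpa, ← hqb, hpq]
      refine ReflTransGen.trans (ReflTransGen.single ?_)
        (reflTransGen_cons (ih (h''.cons a b hab) (by simpa using hF.2.2) hP.of_cons.of_cons) _)
      obtain ⟨hP1, hP2⟩ := hP
      simp only [Multiset.mem_cons, forall_eq_or_imp] at hP1
      obtain ⟨lp, lq, la, lb, -⟩ := hP1
      simp only [Multiset.map_cons, Multiset.count_cons] at hP2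
      -- At most one of `p`, `q`, `a`, `b` is of level `0`, so both pairings have one sum containing
      -- it, and the levels of the sums agree up to order.
      have hlev : (p.2 + a.2 = p.2 + q.2 ∧ q.2 + b.2 = a.2 + b.2) ∨
          (p.2 + a.2 = a.2 + b.2 ∧ q.2 + b.2 = p.2 + q.2) := by
        split_ifs at hP2 <;> omega
      have m1 : p + a ∈ evenPart S e := ⟨add_mem hF.1 hF.2.2.1, by simp [hpa]⟩
      have m2 : q + b ∈ evenPart S e := ⟨add_mem hF.2.1 hF.2.2.2.1, by simp [hqb]⟩
      have m3 : p + q ∈ evenPart S e := ⟨add_mem hF.1 hF.2.1, by simp [hpq]⟩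
      have m4 : a + b ∈ evenPart S e := ⟨add_mem hF.2.2.1 hF.2.2.2.1, by simp [hab]⟩
      rcases hlev with ⟨h1, h2⟩ | ⟨h1, h2⟩
      · exact ⟨p + a, q + b, p + q, a + b, G'', m1, m2, m3, m4, by abel, h1, h2, rfl, rfl⟩
      · exact ⟨p + a, q + b, a + b, p + q, G'', m1, m2, m4, m3, by abel, h1, h2, rfl,
          Multiset.cons_swap _ _ _⟩

/-- A pair move of elements of level `1` lifts to pairings. -/
lemma Pairing.lift_pairMove {F' N₀ : Multiset (Wt E)} (h : Pairing e G (N₀ + F))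
    (hF : ∀ p ∈ N₀ + F, p ∈ S) (hF1 : ∀ p ∈ F, p.2 = 1) (hS : ∀ p ∈ S, TypOne (typeAt e p))
    (hm : PairMove S F F') :
    ∃ G', ReflTransGen (PairMove (evenPart S e)) G G' ∧ Pairing e G' (N₀ + F') := by
  obtain ⟨p, q, p', q', N, hp, hq, hp', hq', hs, hl, hl', rfl, rfl⟩ := hm
  have main : ∀ r s, r ∈ S → s ∈ S → p + q = r + s → p.1 e = r.1 e → q.1 e = s.1 e →
      p.2 = r.2 → q.2 = s.2 → ∃ G', ReflTransGen (PairMove (evenPart S e)) G G' ∧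
        Pairing e G' (r ::ₘ s ::ₘ (N₀ + N)) := by
    intro r s hr hs' hrs h1 h2 h3 h4
    simp only [Multiset.add_cons] at h hF
    rcases h.cases_pair with ⟨hpq, G'', rfl, h''⟩ | ⟨a, b, G'', N', hpa, hqb, rfl, hN, h''⟩
    -- If `p` and `q` are partners, the move does not change their sum, and `G` stays as it is.
    · exact ⟨_, ReflTransGen.refl, by
        rw [hrs]; exact h''.cons r s (by rw [← h1, ← h2, hpq])⟩
    · rw [hN] at hF ⊢
      simp only [Multiset.mem_cons, forall_eq_or_imp] at hF
      refine ⟨(r + a) ::ₘ (s + b) ::ₘ G'', ReflTransGen.single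
        ⟨p + a, q + b, r + a, s + b, G'', ⟨add_mem hF.1 hF.2.2.1, by simp [hpa]⟩,
          ⟨add_mem hF.2.1 hF.2.2.2.1, by simp [hqb]⟩, ⟨add_mem hr hF.2.2.1, by simp [← h1, hpa]⟩,
          ⟨add_mem hs' hF.2.2.2.1, by simp [← h2, hqb]⟩, ?_, by simp [h3], by simp [h4], rfl, rfl⟩,
          ?_⟩
      · rw [add_add_add_comm, hrs, add_add_add_comm]
      · have := (h''.cons s b (by rw [← h2, hqb])).cons r a (by rw [← h1, hpa])
        rwa [Multiset.cons_swap a s] at this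
  have l1 := hF1 p (by simp)
  have l2 := hF1 q (by simp)
  have t1 : p.1 e = 0 ∨ p.1 e = 1 := hS p hp l1
  have t2 : q.1 e = 0 ∨ q.1 e = 1 := hS q hq l2
  have t3 : p'.1 e = 0 ∨ p'.1 e = 1 := hS p' hp' (hl ▸ l1)
  have t4 : q'.1 e = 0 ∨ q'.1 e = 1 := hS q' hq' (hl' ▸ l2)
  have t5 : p.1 e + q.1 e = p'.1 e + q'.1 e := congrFun (congrArg Prod.fst hs) e
  -- Weights in `{0, 1}` with the same sum agree up to order, so the new elements can take over the
  -- partners of the old ones.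
  have t6 : (p.1 e = p'.1 e ∧ q.1 e = q'.1 e) ∨ (p.1 e = q'.1 e ∧ q.1 e = p'.1 e) := by omega
  simp only [Multiset.add_cons]
  rcases t6 with ⟨h1, h2⟩ | ⟨h1, h2⟩
  · exact main p' q' hp' hq' hs h1 h2 hl hl'
  · rw [Multiset.cons_swap]
    exact main q' p' hq' hp' (by rw [hs, add_comm]) h1 h2 (by rw [l1, ← hl', l2])
      (by rw [l2, ← hl, l1])

lemma Pairing.lift_reflTransGen {F' N₀ : Multiset (Wt E)} (h : Pairing e G (N₀ + F))
    (hF : ∀ p ∈ N₀ + F, p ∈ S) (hF1 : ∀ p ∈ F, p.2 = 1) (hS : ∀ p ∈ S, TypOne (typeAt e p))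
    (hm : ReflTransGen (PairMove S) F F') :
    ∃ G', ReflTransGen (PairMove (evenPart S e)) G G' ∧ Pairing e G' (N₀ + F') := by
  induction hm with
  | refl => exact ⟨G, ReflTransGen.refl, h⟩
  | @tail F₁ F₂ hr hm ih =>
    obtain ⟨G₁, hG₁, h₁⟩ := ih
    have hl : ∀ p ∈ F₁, p.2 = 1 := by
      intro p hp
      have : p.2 ∈ F₁.map Prod.snd := Multiset.mem_map_of_mem _ hp
      rw [reflTransGen_map_snd hr] at this
      obtain ⟨q, hq, hqp⟩ := Multiset.mem_map.1 this
      rw [← hqp, hF1 q hq]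
    have hmem : ∀ p ∈ N₀ + F₁, p ∈ S := by
      have := reflTransGen_mem hr fun p hp => hF p (Multiset.mem_add.2 (Or.inr hp))
      intro p hp
      rcases Multiset.mem_add.1 hp with hp | hp
      · exact hF p (Multiset.mem_add.2 (Or.inl hp))
      · exact this p hp
    obtain ⟨G₂, hG₂, h₂⟩ := h₁.lift_pairMove hmem hl hS hm
    exact ⟨G₂, hG₁.trans hG₂, h₂⟩

lemma padded_replicate_add {k : ℕ} (hk : k ≤ 1) (hF : ∀ p ∈ F, p.2 = 1) :
    Padded (Multiset.replicate k 0 + F) := by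
  refine ⟨fun p hp => ?_, ?_⟩
  · rcases Multiset.mem_add.1 hp with hp | hp
    · rw [Multiset.eq_of_mem_replicate hp]
      exact Or.inr rfl
    · exact Or.inl (hF p hp)
  · have : (F.map Prod.snd).count 0 = 0 := by
      rw [Multiset.count_eq_zero]
      intro h0
      obtain ⟨p, hp, hp0⟩ := Multiset.mem_map.1 h0
      have := hF p hp
      omega
    rw [Multiset.map_add, Multiset.count_add, this, Multiset.map_replicate]
    simpa using hk

/-- A sum of two partners has level `1` exactly when one of them is of level `0`, and only one
member of `F` can be. -/
lemma Pairing.admTwo (h : Pairing e G F) (hP : Padded F) : AdmTwo (G.map Prod.snd) := by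
  have key : (∀ l ∈ G.map Prod.snd, l = 1 ∨ l = 2) ∧
      (G.map Prod.snd).count 1 ≤ (F.map Prod.snd).count 0 := by
    induction h with
    | nil => simp
    | @cons G F p q _ _ ih =>
      obtain ⟨ih1, ih2⟩ := ih hP.of_cons.of_cons
      obtain ⟨hP1, hP2⟩ := hP
      simp only [Multiset.mem_cons, forall_eq_or_imp] at hP1
      obtain ⟨lp, lq, -⟩ := hP1
      simp only [Multiset.map_cons, Multiset.count_cons, Multiset.mem_cons, forall_eq_or_imp,
        Prod.snd_add] at hP2 ⊢
      refine ⟨⟨?_, ih1⟩, ?_⟩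
      · split_ifs at hP2 <;> omega
      · split_ifs at hP2 ⊢ <;> omega
  exact ⟨key.1, key.2.trans hP.2⟩

/-- The weights on `e` are `0` or `1`, so among three elements two can be paired. When two are left,
parity makes their weights equal; a single one left has weight `0` and is paired with the padding
element `0`. -/
lemma exists_pairing_of_even (hS : ∀ p ∈ S, TypOne (typeAt e p)) (n : ℕ) :
    ∀ F : Multiset (Wt E), F.card ≤ n → (∀ p ∈ F, p ∈ S) → (∀ p ∈ F, p.2 = 1) →
      Even (F.sum.1 e) → ∃ k ≤ 1, ∃ G, Pairing e G (Multiset.replicate k 0 + F) := by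
  induction n with
  | zero =>
    intro F hF _ _ _
    have : F = 0 := by simpa using hF
    exact ⟨0, zero_le_one, 0, by simpa [this] using Pairing.nil⟩
  | succ n ih =>
    intro F hn hF hF1 hev
    have ht : ∀ p ∈ F, p.1 e = 0 ∨ p.1 e = 1 := fun p hp => hS p (hF p hp) (hF1 p hp)
    have main : ∀ (p q : Wt E) N, F = p ::ₘ q ::ₘ N → p.1 e = q.1 e →
        ∃ k ≤ 1, ∃ G, Pairing e G (Multiset.replicate k 0 + F) := by
      rintro p q N rfl hpq
      obtain ⟨k, hk, G, hG⟩ := ih N (by simp at hn; omega) (fun r hr => hF r (by simp [hr]))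
        (fun r hr => hF1 r (by simp [hr])) (by
          have : (p ::ₘ q ::ₘ N).sum.1 e = q.1 e + q.1 e + N.sum.1 e := by
            simp [hpq, add_assoc]
          rw [this, Int.even_add] at hev
          exact hev.1 ⟨_, rfl⟩)
      exact ⟨k, hk, _, by simpa [Multiset.add_cons] using hG.cons p q hpq⟩
    induction F using Multiset.induction_on with
    | empty => exact ⟨0, zero_le_one, 0, by simpa using Pairing.nil⟩
    | cons p F _ =>
      clear ih
      induction F using Multiset.induction_on with
      | empty =>
        have h0 : p.1 e = 0 := by
          have := ht p (by simp)
          have h2 : Even (p.1 e) := by simpa using hev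
          rw [Int.even_iff] at h2
          omega
        exact ⟨1, le_rfl, _, by simpa using Pairing.nil.cons 0 p (by simp [h0])⟩
      | cons q F _ =>
        by_cases hpq : p.1 e = q.1 e
        · exact main p q F rfl hpq
        have hp := ht p (by simp)
        have hq := ht q (by simp)
        induction F using Multiset.induction_on with
        | empty =>
          have h2 : Even (p.1 e + q.1 e) := by simpa using hev
          rw [Int.even_iff] at h2
          omega
        | cons r F _ =>
          have hr := ht r (by simp)
          by_cases hpr : p.1 e = r.1 e
          · exact main p r (q ::ₘ F) (by rw [Multiset.cons_swap q r]) hpr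
          · exact main q r (p ::ₘ F)
              (by rw [Multiset.cons_swap p q, Multiset.cons_swap p r]) (by omega)

/-- An element of level `2` splits into two of level `1`, whose weights on `e` lie in `{0, 1}` and
have even sum, hence are equal. An element of level `1` has even weight, hence weight `0`, and is
paired with a padding `0`. -/
lemma exists_pairing_of_levels (h : Quad AdmOne S) (hS : ∀ p ∈ S, TypOne (typeAt e p))
    (hG : ∀ p ∈ G, p ∈ evenPart S e) (hl : ∀ p ∈ G, p.2 = 1 ∨ p.2 = 2) :
    ∃ F, (∀ p ∈ F, p ∈ S) ∧ (∀ p ∈ F, p.2 = 1) ∧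
      Pairing e G (Multiset.replicate ((G.map Prod.snd).count 1) 0 + F) := by
  induction G using Multiset.induction_on with
  | empty => exact ⟨0, by simp, by simp, by simpa using Pairing.nil⟩
  | cons x G ih =>
    simp only [Multiset.mem_cons, forall_eq_or_imp] at hG hl
    obtain ⟨F, hF, hF1, hP⟩ := ih hG.2 hl.2
    obtain ⟨hx, hxe⟩ := mem_evenPart.1 hG.1
    rcases hl.1 with hx1 | hx2
    · have h0 : x.1 e = 0 := by
        have : x.1 e = 0 ∨ x.1 e = 1 := hS x hx hx1
        rw [Int.even_iff] at hxe
        omega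
      refine ⟨x ::ₘ F, by simpa [hx] using hF, by simpa [hx1] using hF1, ?_⟩
      have := hP.cons 0 x (by simp [h0])
      simpa [hx1, Multiset.add_cons, Multiset.replicate_succ, Multiset.cons_swap x 0] using this
    · obtain ⟨Fx, hFx, hsum⟩ := h.gen x hx
      have hc : Fx.card = 2 := by
        rw [← hx2, ← hsum, multiset_sum_snd, Multiset.eq_replicate_card.2 hFx.2]
        simp
      obtain ⟨p, q, rfl⟩ := Multiset.card_eq_two.1 hc
      have hp := hFx.1 p (by simp)
      have hq := hFx.1 q (by simp)
      have lp : p.2 = 1 := hFx.2 _ (by simp)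
      have lq : q.2 = 1 := hFx.2 _ (by simp)
      have hx' : p + q = x := by simpa using hsum
      have hpq : p.1 e = q.1 e := by
        have h1 : p.1 e = 0 ∨ p.1 e = 1 := hS p hp lp
        have h2 : q.1 e = 0 ∨ q.1 e = 1 := hS q hq lq
        rw [← hx', Int.even_iff, Prod.fst_add, Pi.add_apply] at hxe
        omega
      refine ⟨p ::ₘ q ::ₘ F, by simpa [hp, hq] using hF, by simpa [lp, lq] using hF1, ?_⟩
      have := hP.cons p q hpq
      simpa [hx', hx2, Multiset.add_cons] using this

/-- If `S` is quadratically presented in level `1`, then so is its even part in level `2`. -/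
theorem Quad.evenPart (h : Quad AdmOne S) (hS : ∀ p ∈ S, TypOne (typeAt e p)) :
    Quad AdmTwo (evenPart S e) where
  gen s hs := by
    obtain ⟨F, hF, rfl⟩ := h.gen s hs.1
    have hF1 : ∀ p ∈ F, p.2 = 1 := fun p hp => hF.2 _ (Multiset.mem_map_of_mem _ hp)
    obtain ⟨k, hk, G, hG⟩ := exists_pairing_of_even hS _ F le_rfl hF.1 hF1 hs.2
    refine ⟨G, ⟨hG.mem fun p hp => ?_, hG.admTwo (padded_replicate_add hk hF1)⟩, ?_⟩
    · rcases Multiset.mem_add.1 hp with hp | hp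
      · rw [Multiset.eq_of_mem_replicate hp]
        exact zero_mem _
      · exact hF.1 p hp
    · rw [hG.sum_eq]; simp
  conn G G' hG hG' hs := by
    obtain ⟨F, hF, hF1, hP⟩ := exists_pairing_of_levels h hS hG.1
      fun p hp => hG.2.1 _ (Multiset.mem_map_of_mem _ hp)
    obtain ⟨F', hF', hF1', hP'⟩ := exists_pairing_of_levels h hS hG'.1
      fun p hp => hG'.2.1 _ (Multiset.mem_map_of_mem _ hp)
    have hk := hG.2.2
    have hk' := hG'.2.2
    generalize (G.map Prod.snd).count 1 = k at hk hP
    generalize (G'.map Prod.snd).count 1 = k' at hk' hP'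
    have hsum : F.sum = F'.sum := by
      have h1 := hP.sum_eq
      have h2 := hP'.sum_eq
      simp only [Multiset.sum_add, Multiset.sum_replicate, smul_zero, zero_add] at h1 h2
      rw [← h1, ← h2, hs]
    have hcard : ∀ F : Multiset (Wt E), (∀ p ∈ F, p.2 = 1) → F.card = F.sum.2 := by
      intro F hF
      rw [multiset_sum_snd, Multiset.map_congr rfl hF]
      simp
    have e1 := hP.even_card
    have e2 := hP'.even_card
    simp only [Multiset.card_add, Multiset.card_replicate, hcard F hF1, hcard F' hF1', hsum,
      Nat.even_iff] at e1 e2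
    -- A paired multiset has even size, and the size of `F` is the level of its sum; so the number
    -- of paddings, at most one, is determined by parity.
    obtain rfl : k = k' := by omega
    have adm : ∀ F : Multiset (Wt E), (∀ p ∈ F, p.2 = 1) → AdmOne (F.map Prod.snd) := by
      intro F hF l hl
      obtain ⟨p, hp, rfl⟩ := Multiset.mem_map.1 hl
      exact hF p hp
    have mem : ∀ F : Multiset (Wt E), (∀ p ∈ F, p ∈ S) →
        ∀ p ∈ Multiset.replicate k 0 + F, p ∈ S := by
      intro F hF p hp
      rcases Multiset.mem_add.1 hp with hp | hp
      · rw [Multiset.eq_of_mem_replicate hp]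
        exact zero_mem _
      · exact hF p hp
    -- Moves from `F` to `F'` in level `1` carry `G` to some pairing of `F'`; any two pairings of
    -- `F'` are connected.
    obtain ⟨G₁, hG₁, hP₁⟩ := hP.lift_reflTransGen (mem F hF) hF1 hS
      (h.conn F F' ⟨hF, adm F hF1⟩ ⟨hF', adm F' hF1'⟩ hsum)
    exact hG₁.trans (hP'.connected hP₁ (mem F' hF') (padded_replicate_add hk hF1'))

end Pairing

/-! ### The monoids of a trivalent vertex and of a bigon -/

/-- One trivalent vertex with three leaf edges. -/
def tripod : TrivalentGraph where
  V := Unit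
  E := Fin 3
  inc := fun _ i => i

/-- The lattice points of the tripod. -/
def tripodPoints : AddSubmonoid (Wt (Fin 3)) := tripod.latticePoints

/-- The linear form of the conditions at a trivalent vertex. -/
def VertexCond (a b c : ℤ) (L : ℕ) : Prop :=
  a + b + c ≤ 2 * L ∧ a ≤ b + c ∧ b ≤ a + c ∧ c ≤ a + b ∧ (a + b + c) % 2 = 0

lemma vertexCond_iff {a b c : ℤ} {L : ℕ} : VertexCond a b c L ↔
    (a + b + c ≤ 2 * (L : ℤ) ∧ |a - b| ≤ c ∧ c ≤ a + b ∧ Even (a + b + c)) := by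
  unfold VertexCond
  rw [abs_le, Int.even_iff]
  omega

lemma TrivalentGraph.mem_latticePoints {Γ : TrivalentGraph} {p : Wt Γ.E} :
    p ∈ Γ.latticePoints ↔ (∀ e, 0 ≤ p.1 e) ∧
      ∀ v, VertexCond (p.1 (Γ.inc v 0)) (p.1 (Γ.inc v 1)) (p.1 (Γ.inc v 2)) p.2 := by
  simp only [vertexCond_iff]
  rfl

lemma mem_tripodPoints {p : Wt (Fin 3)} :
    p ∈ tripodPoints ↔ VertexCond (p.1 0) (p.1 1) (p.1 2) p.2 := by
  refine TrivalentGraph.mem_latticePoints.trans ⟨fun h => h.2 (), fun h => ⟨fun e => ?_, fun _ => h⟩⟩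
  unfold VertexCond at h
  change Fin 3 at e
  fin_cases e <;> simp <;> omega

/-- The weights `(a, u, v, c)` of a bigon with edges `u`, `v` and outer edges `a`, `c`, the weights on
which are even. -/
def bigonPoints : AddSubmonoid (Wt (Fin 4)) :=
  evenPart (tripodPoints.comap (restrict ![0, 1, 2]) ⊓ tripodPoints.comap (restrict ![3, 1, 2])) 0

lemma mem_bigonPoints {p : Wt (Fin 4)} :
    p ∈ bigonPoints ↔ VertexCond (p.1 0) (p.1 1) (p.1 2) p.2 ∧
      VertexCond (p.1 3) (p.1 1) (p.1 2) p.2 ∧ p.1 0 % 2 = 0 := by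
  rw [← Int.even_iff, ← and_assoc]
  unfold bigonPoints
  rw [mem_evenPart, AddSubmonoid.mem_inf, AddSubmonoid.mem_comap, AddSubmonoid.mem_comap,
    mem_tripodPoints, mem_tripodPoints]
  rfl

/-! ### Generators and normal forms for the vertex and the bigon -/

lemma exists_factorization_one {E : Type} {S : AddSubmonoid (Wt E)}
    (h0 : ∀ s ∈ S, s.2 = 0 → s = 0)
    (h1 : ∀ s ∈ S, s.2 ≠ 0 → ∃ p ∈ S, ∃ s' ∈ S, p.2 = 1 ∧ s = p + s') (n : ℕ) :
    ∀ s ∈ S, s.2 = n → ∃ F, IsFactorization AdmOne S F ∧ F.sum = s := by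
  induction n with
  | zero => exact fun s hs hl => ⟨0, ⟨by simp, by simp [AdmOne]⟩, (h0 s hs hl).symm⟩
  | succ n ih =>
    intro s hs hl
    obtain ⟨p, hp, s', hs', hpl, rfl⟩ := h1 s hs (by omega)
    obtain ⟨F, hF, rfl⟩ := ih s' hs' (by simp at hl; omega)
    refine ⟨p ::ₘ F, ⟨by simpa [hp] using hF.1, ?_⟩, by simp⟩
    have := hF.2
    simp only [AdmOne, Multiset.map_cons, Multiset.mem_cons, forall_eq_or_imp] at this ⊢
    exact ⟨hpl, this⟩

/-- Elements of level `2` are peeled off until the level is at most `1`; only the final remainder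
can contribute a member of level `1`. -/
lemma exists_factorization_two {E : Type} {S : AddSubmonoid (Wt E)}
    (h0 : ∀ s ∈ S, s.2 = 0 → s = 0)
    (h1 : ∀ s ∈ S, 2 ≤ s.2 → ∃ p ∈ S, ∃ s' ∈ S, p.2 = 2 ∧ s = p + s') (n : ℕ) :
    ∀ s ∈ S, s.2 ≤ n → ∃ F, IsFactorization AdmTwo S F ∧ F.sum = s := by
  induction n with
  | zero => exact fun s hs hl => ⟨0, ⟨by simp, by simp [AdmTwo]⟩, (h0 s hs (by omega)).symm⟩
  | succ n ih =>
    intro s hs hl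
    by_cases hs0 : s.2 = 0
    · exact ⟨0, ⟨by simp, by simp [AdmTwo]⟩, (h0 s hs (by omega)).symm⟩
    by_cases hs1 : s.2 = 1
    · exact ⟨{s}, ⟨by simpa using hs, by simp [AdmTwo, hs1]⟩, by simp⟩
    obtain ⟨p, hp, s', hs', hpl, rfl⟩ := h1 s hs (by omega)
    obtain ⟨F, hF, rfl⟩ := ih s' hs' (by simp at hl; omega)
    refine ⟨p ::ₘ F, ⟨by simpa [hp] using hF.1, ?_⟩, by simp⟩
    have := hF.2
    simp only [AdmTwo, Multiset.map_cons, Multiset.mem_cons, forall_eq_or_imp] at this ⊢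
    rw [Multiset.count_cons_of_ne (by omega)]
    exact ⟨⟨Or.inr hpl, this.1⟩, this.2⟩

lemma exists_map_eq {ι α : Type*} {g : ι → α} {F : Multiset α} (h : ∀ p ∈ F, ∃ k, g k = p) :
    ∃ F₀ : Multiset ι, F₀.map g = F := by
  induction F using Multiset.induction_on with
  | empty => exact ⟨0, rfl⟩
  | cons p F ih =>
    simp only [Multiset.mem_cons, forall_eq_or_imp] at h
    obtain ⟨k, rfl⟩ := h.1
    obtain ⟨F₀, rfl⟩ := ih h.2
    exact ⟨k ::ₘ F₀, by simp⟩

lemma sum_map_eq_sum_count {ι α : Type*} [Fintype ι] [DecidableEq ι] [AddCommMonoid α] (g : ι → α)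
    (F : Multiset ι) : (F.map g).sum = ∑ k, F.count k • g k := by
  rw [Finset.sum_multiset_map_count]
  refine Finset.sum_subset (Finset.subset_univ _) fun k _ hk => ?_
  rw [Multiset.mem_toFinset] at hk
  simp [Multiset.count_eq_zero.2 hk]

/-- The elements of level `1` of the tripod. -/
def tripodGen : Fin 4 → Wt (Fin 3) :=
  ![(![0, 0, 0], 1), (![1, 1, 0], 1), (![1, 0, 1], 1), (![0, 1, 1], 1)]

lemma wt3_ext {p q : Wt (Fin 3)} (h0 : p.1 0 = q.1 0) (h1 : p.1 1 = q.1 1) (h2 : p.1 2 = q.1 2)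
    (h : p.2 = q.2) : p = q := by
  refine Prod.ext (funext fun e => ?_) h
  fin_cases e <;> assumption

lemma exists_tripodGen {p : Wt (Fin 3)} (hp : p ∈ tripodPoints) (hl : p.2 = 1) :
    ∃ k, tripodGen k = p := by
  rw [mem_tripodPoints, VertexCond] at hp
  have : (p.1 0 = 0 ∧ p.1 1 = 0 ∧ p.1 2 = 0) ∨ (p.1 0 = 1 ∧ p.1 1 = 1 ∧ p.1 2 = 0) ∨
    (p.1 0 = 1 ∧ p.1 1 = 0 ∧ p.1 2 = 1) ∨ (p.1 0 = 0 ∧ p.1 1 = 1 ∧ p.1 2 = 1) := by omega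
  rcases this with h | h | h | h
  · exact ⟨0, wt3_ext h.1.symm h.2.1.symm h.2.2.symm hl.symm⟩
  · exact ⟨1, wt3_ext h.1.symm h.2.1.symm h.2.2.symm hl.symm⟩
  · exact ⟨2, wt3_ext h.1.symm h.2.1.symm h.2.2.symm hl.symm⟩
  · exact ⟨3, wt3_ext h.1.symm h.2.1.symm h.2.2.symm hl.symm⟩

/-- The semigroup is free on `tripodGen`: for weights `a, b, c` the multiplicities are `L - (a + b +
c) / 2`, `(a + b - c) / 2`, `(a + c - b) / 2` and `(b + c - a) / 2`. Hence factorizations are unique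
and no moves are needed. -/
theorem quad_tripodPoints : Quad AdmOne tripodPoints where
  gen s hs := by
    refine exists_factorization_one ?_ ?_ s.2 s hs rfl
    · intro s hs hl
      rw [mem_tripodPoints, VertexCond] at hs
      apply wt3_ext <;> simp <;> omega
    · intro s hs hl
      have main : ∀ x y z : ℤ, VertexCond x y z 1 →
          VertexCond (s.1 0 - x) (s.1 1 - y) (s.1 2 - z) (s.2 - 1) →
          ∃ p ∈ tripodPoints, ∃ s' ∈ tripodPoints, p.2 = 1 ∧ s = p + s' := by
        intro x y z h1 h2
        refine ⟨(![x, y, z], 1), mem_tripodPoints.2 h1,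
          (![s.1 0 - x, s.1 1 - y, s.1 2 - z], s.2 - 1), mem_tripodPoints.2 h2, rfl, ?_⟩
        apply wt3_ext <;> simp
        omega
      rw [mem_tripodPoints] at hs
      unfold VertexCond at hs main
      -- Each generator lowers the slack of exactly one of the four inequalities, by `2`. A strict
      -- triangle inequality has slack at least `2` by parity; if all three are equalities, the
      -- weights vanish.
      by_cases h1 : s.1 0 < s.1 1 + s.1 2
      · exact main 0 1 1 (by norm_num) (by omega)
      by_cases h2 : s.1 1 < s.1 0 + s.1 2
      · exact main 1 0 1 (by norm_num) (by omega)
      by_cases h3 : s.1 2 < s.1 0 + s.1 1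
      · exact main 1 1 0 (by norm_num) (by omega)
      · exact main 0 0 0 (by norm_num) (by omega)
  conn F F' hF hF' hs := by
    have key : ∀ F, IsFactorization AdmOne tripodPoints F →
        ∃ F₀ : Multiset (Fin 4), F₀.map tripodGen = F :=
      fun F hF => exists_map_eq fun p hp =>
        exists_tripodGen (hF.1 p hp) (hF.2 _ (Multiset.mem_map_of_mem _ hp))
    obtain ⟨F₀, rfl⟩ := key F hF
    obtain ⟨F₀', rfl⟩ := key F' hF'
    rw [sum_map_eq_sum_count, sum_map_eq_sum_count] at hs
    have e0 := congrFun (congrArg Prod.fst hs) 0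
    have e1 := congrFun (congrArg Prod.fst hs) 1
    have e2 := congrFun (congrArg Prod.fst hs) 2
    have e3 := congrArg Prod.snd hs
    simp [Fin.sum_univ_four, tripodGen] at e0 e1 e2 e3
    have : F₀ = F₀' := by
      ext k
      fin_cases k <;> simp <;> omega
    rw [this]

/-- The elements of level `1` and `2` of the bigon. -/
def bigonGen : Fin 10 → Wt (Fin 4) :=
  ![(![0, 0, 0, 0], 1), (![0, 1, 1, 0], 1),
    (![0, 0, 0, 0], 2), (![0, 1, 1, 0], 2), (![0, 2, 2, 0], 2),
    (![2, 1, 1, 0], 2), (![0, 1, 1, 2], 2),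
    (![2, 0, 2, 2], 2), (![2, 1, 1, 2], 2), (![2, 2, 0, 2], 2)]

lemma wt4_ext {p q : Wt (Fin 4)} (h0 : p.1 0 = q.1 0) (h1 : p.1 1 = q.1 1) (h2 : p.1 2 = q.1 2)
    (h3 : p.1 3 = q.1 3) (h : p.2 = q.2) : p = q := by
  refine Prod.ext (funext fun e => ?_) h
  fin_cases e <;> assumption

lemma exists_bigonGen {p : Wt (Fin 4)} (hp : p ∈ bigonPoints) (hl : p.2 = 1 ∨ p.2 = 2) :
    ∃ k, bigonGen k = p := by
  rw [mem_bigonPoints, VertexCond, VertexCond] at hp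
  have aux : ∀ (k : Fin 10), (bigonGen k).1 0 = p.1 0 ∧ (bigonGen k).1 1 = p.1 1 ∧
      (bigonGen k).1 2 = p.1 2 ∧ (bigonGen k).1 3 = p.1 3 ∧ (bigonGen k).2 = p.2 →
      ∃ k, bigonGen k = p :=
    fun k h => ⟨k, wt4_ext h.1 h.2.1 h.2.2.1 h.2.2.2.1 h.2.2.2.2⟩
  rcases hl with hl | hl
  · obtain ⟨h0, h3, h2⟩ : p.1 0 = 0 ∧ p.1 3 = 0 ∧ p.1 2 = p.1 1 := by omega
    have h1 : p.1 1 = 0 ∨ p.1 1 = 1 := by omega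
    rcases h1 with h1 | h1
    · exact aux 0 (by simp [bigonGen, h0, h1, h2, h3, hl])
    · exact aux 1 (by simp [bigonGen, h0, h1, h2, h3, hl])
  · have h0 : p.1 0 = 0 ∨ p.1 0 = 2 := by omega
    have h3 : p.1 3 = 0 ∨ p.1 3 = 2 := by omega
    rcases h0 with h0 | h0 <;> rcases h3 with h3 | h3
    · have h2 : p.1 2 = p.1 1 := by omega
      have h1 : p.1 1 = 0 ∨ p.1 1 = 1 ∨ p.1 1 = 2 := by omega
      rcases h1 with h1 | h1 | h1
      · exact aux 2 (by simp [bigonGen, h0, h1, h2, h3, hl])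
      · exact aux 3 (by simp [bigonGen, h0, h1, h2, h3, hl])
      · exact aux 4 (by simp [bigonGen, h0, h1, h2, h3, hl])
    · obtain ⟨h1, h2⟩ : p.1 1 = 1 ∧ p.1 2 = 1 := by omega
      exact aux 6 (by simp [bigonGen, h0, h1, h2, h3, hl])
    · obtain ⟨h1, h2⟩ : p.1 1 = 1 ∧ p.1 2 = 1 := by omega
      exact aux 5 (by simp [bigonGen, h0, h1, h2, h3, hl])
    · have h2 : p.1 2 = 2 - p.1 1 := by omega
      have h1 : p.1 1 = 0 ∨ p.1 1 = 1 ∨ p.1 1 = 2 := by omega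
      rcases h1 with h1 | h1 | h1
      · exact aux 7 (by simp [bigonGen, h0, h1, h2, h3, hl])
      · exact aux 8 (by simp [bigonGen, h0, h1, h2, h3, hl])
      · exact aux 9 (by simp [bigonGen, h0, h1, h2, h3, hl])

lemma bigonGen_mem (k : Fin 10) : bigonGen k ∈ bigonPoints := by
  rw [mem_bigonPoints, VertexCond, VertexCond]
  fin_cases k <;> simp [bigonGen]

lemma exists_bigon_factorization {s : Wt (Fin 4)} (hs : s ∈ bigonPoints) :
    ∃ F, IsFactorization AdmTwo bigonPoints F ∧ F.sum = s := by
  refine exists_factorization_two ?_ ?_ s.2 s hs le_rfl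
  · intro s hs hl
    rw [mem_bigonPoints, VertexCond, VertexCond] at hs
    apply wt4_ext <;> simp <;> omega
  · intro s hs hl
    have main : ∀ x y z w : ℤ, (VertexCond x y z 2 ∧ VertexCond w y z 2 ∧ x % 2 = 0) →
        (VertexCond (s.1 0 - x) (s.1 1 - y) (s.1 2 - z) (s.2 - 2) ∧
        VertexCond (s.1 3 - w) (s.1 1 - y) (s.1 2 - z) (s.2 - 2) ∧ (s.1 0 - x) % 2 = 0) →
        ∃ p ∈ bigonPoints, ∃ s' ∈ bigonPoints, p.2 = 2 ∧ s = p + s' := by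
      intro x y z w h1 h2
      refine ⟨(![x, y, z, w], 2), mem_bigonPoints.2 h1,
        (![s.1 0 - x, s.1 1 - y, s.1 2 - z, s.1 3 - w], s.2 - 2), mem_bigonPoints.2 h2, rfl, ?_⟩
      apply wt4_ext <;> simp
      omega
    rw [mem_bigonPoints] at hs
    unfold VertexCond at hs main
    by_cases ha : s.1 0 = 0
    · by_cases hc : s.1 3 = 0
      · by_cases h1 : s.1 1 = 0
        · exact main 0 0 0 0 (by norm_num) (by omega)
        -- Here both parallel edges carry the same weight, at most the level; if it equals the
        -- level, each summand must be extremal as well.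
        · by_cases h2 : s.1 1 < s.2
          · exact main 0 1 1 0 (by norm_num) (by omega)
          · exact main 0 2 2 0 (by norm_num) (by omega)
      · exact main 0 1 1 2 (by norm_num) (by omega)
    · by_cases hc : s.1 3 = 0
      · exact main 2 1 1 0 (by norm_num) (by omega)
      -- The difference of the parallel weights is bounded by the smaller outer weight, which drops
      -- by `2`. If the bound is attained, the generator has to lower the difference too; otherwise
      -- the gap is at least `2` by parity.
      · by_cases h1 : s.1 1 - s.1 2 = min (s.1 0) (s.1 3)
        · exact main 2 2 0 2 (by norm_num) (by omega)
        · by_cases h2 : s.1 2 - s.1 1 = min (s.1 0) (s.1 3)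
          · exact main 2 0 2 2 (by norm_num) (by omega)
          · exact main 2 1 1 2 (by norm_num) (by omega)

/-- Multisets of generators of the bigon to which none of the reducing moves applies. -/
def BigonNormal (F : Multiset (Fin 10)) : Prop :=
  (F.count 5 = 0 ∨ F.count 6 = 0) ∧ (F.count 2 = 0 ∨ F.count 4 = 0) ∧
  (F.count 7 = 0 ∨ F.count 9 = 0) ∧ (F.count 1 = 0 ∨ F.count 2 = 0) ∧
  (F.count 1 = 0 ∨ F.count 3 = 0)

/-- A weight that is decreased by the reducing moves. -/
def bigonEnergy : Fin 10 → ℕ := ![0, 2, 1, 0, 1, 1, 1, 1, 0, 1]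

/-- With generators written by index, the reducing moves are `5 + 6 = 8 + 3`, `2 + 4 = 3 + 3`, `7 +
9 = 8 + 8`, `1 + 2 = 0 + 3` and `1 + 3 = 0 + 4`. Each lowers `bigonEnergy`, so reduction terminates.
-/
lemma exists_bigonNormal (n : ℕ) : ∀ F : Multiset (Fin 10), (F.map bigonEnergy).sum ≤ n →
    ∃ F', BigonNormal F' ∧
      ReflTransGen (PairMove bigonPoints) (F.map bigonGen) (F'.map bigonGen) := by
  induction n using Nat.strong_induction_on with
  | _ n ih =>
  intro F hn
  by_cases hF : BigonNormal F
  · exact ⟨F, hF, ReflTransGen.refl⟩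
  have red : ∀ k l k' l' : Fin 10, k ≠ l → F.count k ≠ 0 → F.count l ≠ 0 →
      bigonGen k + bigonGen l = bigonGen k' + bigonGen l' →
      (bigonGen k).2 = (bigonGen k').2 → (bigonGen l).2 = (bigonGen l').2 →
      bigonEnergy k' + bigonEnergy l' < bigonEnergy k + bigonEnergy l →
      ∃ F', BigonNormal F' ∧
        ReflTransGen (PairMove bigonPoints) (F.map bigonGen) (F'.map bigonGen) := by
    intro k l k' l' hkl hk hl hs h1 h2 he
    rw [Multiset.count_ne_zero] at hk hl
    obtain ⟨N, rfl⟩ := Multiset.exists_cons_of_mem hk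
    obtain ⟨N, rfl⟩ := Multiset.exists_cons_of_mem
      ((Multiset.mem_cons.1 hl).resolve_left (Ne.symm hkl))
    simp only [Multiset.map_cons, Multiset.sum_cons] at hn
    obtain ⟨F', hF', hr⟩ := ih (bigonEnergy k' + (bigonEnergy l' + (N.map bigonEnergy).sum))
      (by omega) (k' ::ₘ l' ::ₘ N) (by simp)
    refine ⟨F', hF', ReflTransGen.head ?_ hr⟩
    exact ⟨_, _, _, _, N.map bigonGen, bigonGen_mem k, bigonGen_mem l, bigonGen_mem k',
      bigonGen_mem l', hs, h1, h2, by simp, by simp⟩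
  unfold BigonNormal at hF
  by_cases c1 : F.count 5 = 0 ∨ F.count 6 = 0
  · by_cases c2 : F.count 2 = 0 ∨ F.count 4 = 0
    · by_cases c3 : F.count 7 = 0 ∨ F.count 9 = 0
      · by_cases c4 : F.count 1 = 0 ∨ F.count 2 = 0
        · have c5 : ¬ (F.count 1 = 0 ∨ F.count 3 = 0) := fun c5 => hF ⟨c1, c2, c3, c4, c5⟩
          rw [not_or] at c5
          exact red 1 3 0 4 (by decide) c5.1 c5.2 (by simp [bigonGen])
            rfl rfl (by decide)
        · rw [not_or] at c4
          exact red 1 2 0 3 (by decide) c4.1 c4.2 (by simp [bigonGen])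
            rfl rfl (by decide)
      · rw [not_or] at c3
        exact red 7 9 8 8 (by decide) c3.1 c3.2 (by simp [bigonGen])
          rfl rfl (by decide)
    · rw [not_or] at c2
      exact red 2 4 3 3 (by decide) c2.1 c2.2 (by simp [bigonGen]) rfl rfl (by decide)
  · rw [not_or] at c1
    exact red 5 6 8 3 (by decide) c1.1 c1.2 (by simp [bigonGen]) rfl rfl (by decide)

/-- A normal multiset with at most one member of level `1` is determined by its sum, so two
factorizations of the same element reduce to the same normal form. The difference of the outer
weights gives the counts of `5` and `6`, that of the parallel weights the counts of `7` and `9`, and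
then `8` follows. -/
theorem quad_bigonPoints : Quad AdmTwo bigonPoints where
  gen s hs := exists_bigon_factorization hs
  conn F F' hF hF' hs := by
    have key : ∀ F, IsFactorization AdmTwo bigonPoints F → ∃ F₀, BigonNormal F₀ ∧
        ReflTransGen (PairMove bigonPoints) F (F₀.map bigonGen) := by
      intro F hF
      obtain ⟨F₁, rfl⟩ := exists_map_eq (g := bigonGen) (F := F) fun p hp =>
        exists_bigonGen (hF.1 p hp) (hF.2.1 _ (Multiset.mem_map_of_mem _ hp))
      exact exists_bigonNormal _ F₁ le_rfl
    obtain ⟨F₀, hN, hr⟩ := key F hF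
    obtain ⟨F₀', hN', hr'⟩ := key F' hF'
    have cnt : ∀ F : Multiset (Fin 10), AdmTwo ((F.map bigonGen).map Prod.snd) →
        F.count 0 + F.count 1 ≤ 1 := by
      intro F hF
      refine le_trans ?_ hF.2
      rw [Multiset.map_map]
      clear hF
      induction F using Multiset.induction_on with
      | empty => simp
      | cons k F ih =>
        rw [Multiset.map_cons, Multiset.count_cons, Multiset.count_cons, Multiset.count_cons]
        have : (if (0 : Fin 10) = k then 1 else 0) + (if (1 : Fin 10) = k then 1 else 0) ≤
            if 1 = (Prod.snd ∘ bigonGen) k then 1 else 0 := by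
          fin_cases k <;> simp [bigonGen]
        omega
    have c := cnt _ (reflTransGen_isFactorization hr hF).2
    have c' := cnt _ (reflTransGen_isFactorization hr' hF').2
    have hs' : (F₀.map bigonGen).sum = (F₀'.map bigonGen).sum := by
      rw [reflTransGen_sum_eq hr, reflTransGen_sum_eq hr', hs]
    suffices F₀ = F₀' by
      subst this
      exact hr.trans (reflTransGen_symm hr')
    rw [sum_map_eq_sum_count, sum_map_eq_sum_count] at hs'
    have e0 := congrFun (congrArg Prod.fst hs') 0
    have e1 := congrFun (congrArg Prod.fst hs') 1
    have e2 := congrFun (congrArg Prod.fst hs') 2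
    have e3 := congrFun (congrArg Prod.fst hs') 3
    have e4 := congrArg Prod.snd hs'
    simp [Fin.sum_univ_succ, bigonGen] at e0 e1 e2 e3 e4
    obtain ⟨n1, n2, n3, n4, n5⟩ := hN
    obtain ⟨n1', n2', n3', n4', n5'⟩ := hN'
    have d : F₀.count 5 = F₀'.count 5 ∧ F₀.count 6 = F₀'.count 6 := by
      clear n2 n2' n3 n3' n4 n4' n5 n5' e1 e2
      omega
    have d' : F₀.count 7 = F₀'.count 7 ∧ F₀.count 9 = F₀'.count 9 := by
      clear n2 n2' n1 n1' n4 n4' n5 n5'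
      omega
    have d'' : F₀.count 8 = F₀'.count 8 := by
      clear n2 n2' n1 n1' n4 n4' n5 n5' n3 n3'
      omega
    clear n1 n1' n3 n3'
    have d₀ : F₀.count 0 + F₀.count 1 = F₀'.count 0 + F₀'.count 1 := by
      clear n2 n2' n4 n4' n5 n5' e1 e2
      omega
    have hN : F₀.count 2 + F₀.count 3 + F₀.count 4 =
        F₀'.count 2 + F₀'.count 3 + F₀'.count 4 := by
      clear n2 n2' n4 n4' n5 n5' e1 e2
      omega
    have hM : F₀.count 1 + F₀.count 3 + 2 * F₀.count 4 =
        F₀'.count 1 + F₀'.count 3 + 2 * F₀'.count 4 := by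
      clear n2 n2' n4 n4' n5 n5' e2
      omega
    clear e0 e1 e2 e3 e4
    -- If generator `1` occurs, then `2` and `3` do not, so the quantity in `hM` is `1` plus twice
    -- that in `hN`; otherwise it is at most twice that in `hN`.
    have d₁ : F₀.count 1 = F₀'.count 1 := by
      clear n2 n2'
      omega
    have d₂ : F₀.count 2 = F₀'.count 2 ∧ F₀.count 4 = F₀'.count 4 := by
      clear n4 n4' n5 n5'
      omega
    clear n2 n2' n4 n4' n5 n5'
    ext k
    fin_cases k <;> simp <;> omega

/-! ### Lattice points of the rooted graphs -/

namespace RootedGraph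

/-- The lattice points whose weight on the root is at most the level. -/
def boundedPoints (A : RootedGraph) : AddSubmonoid (Wt A.E) where
  carrier := {p | p ∈ A.latticePoints ∧ p.1 A.root ≤ p.2}
  zero_mem' := ⟨zero_mem _, le_rfl⟩
  add_mem' := fun hp hq => ⟨add_mem hp.1 hq.1, by
    have := hp.2
    have := hq.2
    simp only [Prod.fst_add, Pi.add_apply, Prod.snd_add, Nat.cast_add]
    omega⟩

lemma mem_boundedPoints {A : RootedGraph} {p : Wt A.E} :
    p ∈ A.boundedPoints ↔ p ∈ A.latticePoints ∧ p.1 A.root ≤ p.2 := Iff.rfl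

lemma typOne_boundedPoints (A : RootedGraph) :
    ∀ p ∈ A.boundedPoints, TypOne (typeAt A.root p) := by
  intro p hp hl
  have h1 := (TrivalentGraph.mem_latticePoints.1 hp.1).1 A.root
  have h2 := hp.2
  simp only [typeAt_apply] at hl ⊢
  omega

lemma mem_line {p : Wt line.E} : p ∈ line.latticePoints ↔ 0 ≤ p.1 () :=
  TrivalentGraph.mem_latticePoints.trans
    ⟨fun h => h.1 (), fun h => ⟨fun _ => h, fun v => v.elim⟩⟩

lemma mem_loop {p : Wt loop.E} :
    p ∈ loop.latticePoints ↔ VertexCond (p.1 false) (p.1 true) (p.1 true) p.2 := by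
  refine TrivalentGraph.mem_latticePoints.trans
    ⟨fun h => h.2 (), fun h => ⟨fun e => ?_, fun _ => h⟩⟩
  unfold VertexCond at h
  change Bool at e
  cases e <;> omega

lemma mem_bigon {A : RootedGraph} {p : Wt A.bigon.E} :
    p ∈ A.bigon.latticePoints ↔ restrict Sum.inl p ∈ A.latticePoints ∧
      VertexCond (p.1 (Sum.inl A.root)) (p.1 (Sum.inr 0)) (p.1 (Sum.inr 1)) p.2 ∧
      VertexCond (p.1 (Sum.inr 2)) (p.1 (Sum.inr 0)) (p.1 (Sum.inr 1)) p.2 := by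
  rw [TrivalentGraph.mem_latticePoints, TrivalentGraph.mem_latticePoints]
  constructor
  · rintro ⟨h1, h2⟩
    exact ⟨⟨fun e => h1 (Sum.inl e), fun v => h2 (Sum.inl v)⟩, h2 (Sum.inr 0), h2 (Sum.inr 1)⟩
  · rintro ⟨⟨h1, h2⟩, h3, h4⟩
    refine ⟨?_, ?_⟩
    · rintro (e | e)
      · exact h1 e
      · unfold VertexCond at h3 h4
        change Fin 3 at e
        fin_cases e <;> simp <;> omega
    · rintro (v | v)
      · exact h2 v
      · change Fin 2 at v
        fin_cases v
        · exact h3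
        · exact h4

lemma mem_node {A B : RootedGraph} {p : Wt (A.node B).E} :
    p ∈ (A.node B).latticePoints ↔ restrict (some ∘ Sum.inl) p ∈ A.latticePoints ∧
      restrict (some ∘ Sum.inr) p ∈ B.latticePoints ∧
      VertexCond (p.1 none) (p.1 (some (Sum.inl A.root))) (p.1 (some (Sum.inr B.root))) p.2 := by
  rw [TrivalentGraph.mem_latticePoints, TrivalentGraph.mem_latticePoints,
    TrivalentGraph.mem_latticePoints]
  constructor
  · rintro ⟨h1, h2⟩
    exact ⟨⟨fun e => h1 (some (Sum.inl e)), fun v => h2 (some (Sum.inl v))⟩,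
      ⟨fun e => h1 (some (Sum.inr e)), fun v => h2 (some (Sum.inr v))⟩, h2 none⟩
  · rintro ⟨⟨h1, h2⟩, ⟨h3, h4⟩, h5⟩
    refine ⟨?_, ?_⟩
    · rintro (_ | e | e)
      · unfold VertexCond at h5
        omega
      · exact h1 e
      · exact h3 e
    · rintro (_ | v | v)
      · exact h5
      · exact h2 v
      · exact h4 v

lemma mem_close {A : RootedGraph} {p : Wt A.close.E} :
    p ∈ A.close.latticePoints ↔ restrict some p ∈ A.latticePoints ∧
      VertexCond (p.1 (some A.root)) (p.1 none) (p.1 none) p.2 := by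
  rw [TrivalentGraph.mem_latticePoints, TrivalentGraph.mem_latticePoints]
  constructor
  · rintro ⟨h1, h2⟩
    exact ⟨⟨fun e => h1 (some e), fun v => h2 (some v)⟩, h2 none⟩
  · rintro ⟨⟨h1, h2⟩, h3⟩
    refine ⟨?_, ?_⟩
    · rintro (_ | e)
      · unfold VertexCond at h3
        omega
      · exact h1 e
    · rintro (_ | v)
      · exact h3
      · exact h2 v

/-- At a vertex, `a ≤ b + c` and `a + b + c ≤ 2 * L` give `a ≤ L`. The bound on the root is thus a
real restriction only for `line`, which has no vertex. -/
lemma boundedPoints_node (A B : RootedGraph) :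
    (A.node B).boundedPoints = (A.node B).latticePoints := by
  ext p
  refine ⟨fun h => h.1, fun h => ⟨h, ?_⟩⟩
  obtain ⟨-, -, h⟩ := mem_node.1 h
  unfold VertexCond at h
  change p.1 none ≤ _
  omega

/-! ### Trees -/

/-- On the face of the tripod where one weight vanishes the other two agree and range over `0, …,
L`, which is a single edge. -/
theorem quad_line : Quad AdmOne line.boundedPoints := by
  have hface : Quad AdmOne (face tripodPoints 2) := quad_tripodPoints.face 2 fun p hp => by
    rw [mem_tripodPoints, VertexCond] at hp
    omega
  refine hface.transfer
    (θ := { toFun := fun p => (![p.1 (), p.1 (), 0], p.2)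
            map_zero' := by apply wt3_ext <;> rfl
            map_add' := fun p q => by apply wt3_ext <;> simp <;> rfl })
    (ψ := restrict fun _ => 0) ?_ ?_ ?_ (fun _ => rfl) (fun _ => rfl)
  · intro p hp
    have h1 := mem_line.1 hp.1
    have h2 : p.1 () ≤ p.2 := hp.2
    refine ⟨mem_tripodPoints.2 ?_, rfl⟩
    simp [VertexCond]
    omega
  · rintro p ⟨hp, hp2⟩
    rw [mem_tripodPoints, VertexCond] at hp
    refine ⟨mem_line.2 ?_, ?_⟩
    · change 0 ≤ p.1 0
      omega
    · change p.1 0 ≤ p.2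
      omega
  · intro p _
    rfl

/-- The new vertex is a tripod: `B` is glued to its leg `2`, then `A` to its leg `1`, and leg `0`
becomes the root. -/
theorem quad_node {A B : RootedGraph} (hA : Quad AdmOne A.boundedPoints)
    (hB : Quad AdmOne B.boundedPoints) : Quad AdmOne (A.node B).boundedPoints := by
  have typ : ∀ k : Fin 3, ∀ p ∈ tripodPoints, TypOne (typeAt k p) := by
    intro k p hp hl
    rw [mem_tripodPoints, VertexCond] at hp
    simp only [typeAt_apply] at hl ⊢
    fin_cases k <;> simp <;> omega
  let j : Fin 3 → Fin 2 ⊕ B.E := ![Sum.inl 0, Sum.inl 1, Sum.inr B.root]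
  let W : AddSubmonoid (Wt (Fin 2 ⊕ B.E)) :=
    B.boundedPoints.comap (restrict Sum.inr) ⊓ tripodPoints.comap (restrict j)
  have hW : Quad AdmOne W := by
    refine hB.glue (i := Sum.inr) (j := j) (a := B.root) (b := 2) quad_tripodPoints ?_
      typeSystem_one (fun p hp _ => B.typOne_boundedPoints p hp) (fun p hp _ => typ 2 p hp)
      (fun p => Iff.rfl)
    refine ⟨rfl, fun x y hxy => ⟨Sum.elim ![y 0, y 1] x, rfl, ?_⟩, ?_⟩
    · funext e
      fin_cases e
      · rfl
      · rfl
      · exact hxy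
    · rintro (e | e)
      · fin_cases e
        · exact Or.inr ⟨0, rfl⟩
        · exact Or.inr ⟨1, rfl⟩
      · exact Or.inl ⟨e, rfl⟩
  let j' : Fin 2 ⊕ B.E → Option (A.E ⊕ B.E) :=
    Sum.elim ![none, some (Sum.inl A.root)] (some ∘ Sum.inr)
  refine hA.glue (i := some ∘ Sum.inl) (j := j') (a := A.root) (b := Sum.inl 1) hW ?_
    typeSystem_one (fun p hp _ => A.typOne_boundedPoints p hp)
    (fun p hp _ => typ 1 _ (AddSubmonoid.mem_inf.1 hp).2) ?_
  · refine ⟨rfl, fun x y hxy =>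
      ⟨fun e => e.elim (y (Sum.inl 0)) (Sum.elim x (y ∘ Sum.inr)), rfl, ?_⟩, ?_⟩
    · funext e
      rcases e with e | e
      · fin_cases e
        · rfl
        · exact hxy
      · rfl
    · rintro (_ | e | e)
      · exact Or.inr ⟨Sum.inl 0, rfl⟩
      · exact Or.inl ⟨e, rfl⟩
      · exact Or.inr ⟨Sum.inr e, rfl⟩
  · intro p
    rw [boundedPoints_node]
    refine mem_node.trans ⟨?_, ?_⟩
    · rintro ⟨h1, h2, h3⟩
      have h4 := h3
      unfold VertexCond at h4
      refine ⟨⟨h1, ?_⟩, AddSubmonoid.mem_inf.2 ⟨⟨h2, ?_⟩, mem_tripodPoints.2 h3⟩⟩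
      · change p.1 (some (Sum.inl A.root)) ≤ p.2
        omega
      · change p.1 (some (Sum.inr B.root)) ≤ p.2
        omega
    · rintro ⟨h1, h2⟩
      obtain ⟨h2, h3⟩ := AddSubmonoid.mem_inf.1 h2
      exact ⟨h1.1, h2.1, mem_tripodPoints.1 h3⟩

end RootedGraph

open RootedGraph

lemma IsRootedGamma.one_le {g n : ℕ} {A : RootedGraph} (h : IsRootedGamma g n A) :
    1 ≤ n ∧ (g = 0 → 2 ≤ n) := by
  induction h with
  | line => simp
  | loop => simp
  | bigon _ ih => simp
  | node _ _ ih1 ih2 =>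
    have := ih1.2 rfl
    refine ⟨by omega, fun _ => by omega⟩

theorem IsRootedGamma.quad_tree {g n : ℕ} {A : RootedGraph} (h : IsRootedGamma g n A)
    (hg : g = 0) : Quad AdmOne A.boundedPoints := by
  induction h with
  | line => exact quad_line
  | loop => omega
  | bigon _ _ => omega
  | node _ _ ih1 ih2 => exact quad_node (ih1 rfl) (ih2 hg)

/-! ### Chains of bigons -/

namespace RootedGraph

lemma bigonPoints_bound {p : Wt (Fin 4)} (hp : p ∈ bigonPoints) :
    (0 ≤ p.1 0 ∧ p.1 0 ≤ p.2 ∧ p.1 0 % 2 = 0) ∧ (0 ≤ p.1 3 ∧ p.1 3 ≤ p.2 ∧ p.1 3 % 2 = 0) := by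
  rw [mem_bigonPoints, VertexCond, VertexCond] at hp
  omega

lemma typTwo_of_even {E : Type} {e : E} {p : Wt E}
    (h : 0 ≤ p.1 e ∧ p.1 e ≤ p.2 ∧ p.1 e % 2 = 0) : TypTwo (typeAt e p) := by
  unfold TypTwo
  simp only [typeAt_apply]
  omega

/-- If one outer weight of a bigon vanishes, the parallel edges have equal weights and act as a
single loop at the other vertex. -/
theorem quad_loop : Quad AdmTwo loop.latticePoints := by
  have hface : Quad AdmTwo (face bigonPoints 3) :=
    quad_bigonPoints.face 3 fun p hp => (bigonPoints_bound hp).2.1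
  refine hface.transfer
    (θ := { toFun := fun p => (![p.1 false, p.1 true, p.1 true, 0], p.2)
            map_zero' := by apply wt4_ext <;> rfl
            map_add' := fun p q => by apply wt4_ext <;> simp <;> rfl })
    (ψ := restrict fun b : Bool => if b then 1 else 0) ?_ ?_ ?_ (fun _ => rfl) (fun _ => rfl)
  · intro p hp
    rw [mem_loop] at hp
    refine ⟨mem_bigonPoints.2 ?_, rfl⟩
    simp [VertexCond] at hp ⊢
    omega
  · rintro p ⟨hp, hp3⟩
    rw [mem_bigonPoints] at hp
    refine mem_loop.2 ?_
    change VertexCond (p.1 0) (p.1 1) (p.1 1) p.2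
    simp only [VertexCond] at hp ⊢
    omega
  · intro p _
    refine Prod.ext (funext fun b => ?_) rfl
    change Bool at b
    cases b <;> rfl

/-- The evenness required in `bigonPoints` is automatic once the outer edge is the root of `A`, so
the new graph is a gluing of `A` and the bigon. -/
theorem quad_bigon {A : RootedGraph} (hA : Quad AdmTwo A.latticePoints)
    (hr : ∀ p ∈ A.latticePoints, 0 ≤ p.1 A.root ∧ p.1 A.root ≤ p.2 ∧ p.1 A.root % 2 = 0) :
    Quad AdmTwo A.bigon.latticePoints := by
  refine hA.glue (i := Sum.inl) (j := ![Sum.inl A.root, Sum.inr 0, Sum.inr 1, Sum.inr 2])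
    (a := A.root) (b := 0) quad_bigonPoints ?_ typeSystem_two
    (fun p hp _ => typTwo_of_even (hr p hp))
    (fun p hp _ => typTwo_of_even (bigonPoints_bound hp).1) ?_
  · refine ⟨rfl, fun x y hxy => ⟨Sum.elim x ![y 1, y 2, y 3], rfl, ?_⟩, ?_⟩
    · funext e
      fin_cases e
      · exact hxy
      · rfl
      · rfl
      · rfl
    · rintro (e | e)
      · exact Or.inl ⟨e, rfl⟩
      · fin_cases e
        · exact Or.inr ⟨1, rfl⟩
        · exact Or.inr ⟨2, rfl⟩
        · exact Or.inr ⟨3, rfl⟩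
  · intro p
    refine mem_bigon.trans ⟨?_, ?_⟩
    · rintro ⟨h1, h2, h3⟩
      exact ⟨h1, mem_bigonPoints.2 ⟨h2, h3, (hr _ h1).2.2⟩⟩
    · rintro ⟨h1, h2⟩
      obtain ⟨h3, h4, -⟩ := mem_bigonPoints.1 h2
      exact ⟨h1, h3, h4⟩

theorem quad_close {A : RootedGraph} (hA : Quad AdmTwo A.latticePoints)
    (hr : ∀ p ∈ A.latticePoints, 0 ≤ p.1 A.root ∧ p.1 A.root ≤ p.2 ∧ p.1 A.root % 2 = 0) :
    Quad AdmTwo A.close.latticePoints := by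
  refine hA.glue (i := some) (j := fun b : Bool => if b then none else some A.root)
    (a := A.root) (b := false) quad_loop ?_ typeSystem_two
    (fun p hp _ => typTwo_of_even (hr p hp)) (fun p hp _ => typTwo_of_even ?_) ?_
  · refine ⟨rfl, fun x y hxy => ⟨fun e => e.elim (y true) x, rfl, ?_⟩, ?_⟩
    · funext b
      cases b
      · exact hxy
      · rfl
    · rintro (_ | e)
      · exact Or.inr ⟨true, rfl⟩
      · exact Or.inl ⟨e, rfl⟩
  · have := mem_loop.1 hp
    unfold VertexCond at this
    omega
  · intro p
    refine mem_close.trans (and_congr Iff.rfl ?_)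
    exact (mem_loop (p := (restrict fun b : Bool => if b then none else some A.root) p)).symm

end RootedGraph

/-- The graphs `Γ(g, 1)` are quadratically presented in level `2`, and the root weights are even. -/
theorem IsRootedGamma.quad_chain {g n : ℕ} {A : RootedGraph} (h : IsRootedGamma g n A)
    (hn : n = 1) : Quad AdmTwo A.latticePoints ∧
      ∀ p ∈ A.latticePoints, 0 ≤ p.1 A.root ∧ p.1 A.root ≤ p.2 ∧ p.1 A.root % 2 = 0 := by
  induction h with
  | line => omega
  | loop =>
    refine ⟨quad_loop, fun p hp => ?_⟩
    have := mem_loop.1 hp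
    unfold VertexCond at this
    change 0 ≤ p.1 false ∧ p.1 false ≤ p.2 ∧ p.1 false % 2 = 0
    omega
  | @bigon g A _ ih =>
    obtain ⟨h1, h2⟩ := ih rfl
    refine ⟨quad_bigon h1 h2, fun p hp => ?_⟩
    obtain ⟨h3, h4, h5⟩ := mem_bigon.1 hp
    -- The even-sum conditions at both ends of the bigon involve the same two parallel edges, so
    -- parity passes from the old root to the new one.
    have h6 : p.1 (Sum.inl A.root) % 2 = 0 := (h2 _ h3).2.2
    unfold VertexCond at h4 h5
    change 0 ≤ p.1 (Sum.inr 2) ∧ p.1 (Sum.inr 2) ≤ p.2 ∧ p.1 (Sum.inr 2) % 2 = 0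
    omega
  -- A node has at least two leaves, since its tree `A` contributes at least one and `B` at least
  -- one more.
  | node h1 h2 _ _ =>
    have := h1.one_le.2 rfl
    have := h2.one_le.1
    omega

/-! ### Chains with trees attached -/

/-- Gluing a chain to a tree along their roots. -/
lemma quad_glue_chain_tree {B T : RootedGraph} (hB : Quad AdmTwo B.latticePoints)
    (hr : ∀ p ∈ B.latticePoints, 0 ≤ p.1 B.root ∧ p.1 B.root ≤ p.2 ∧ p.1 B.root % 2 = 0)
    (hT : Quad AdmOne T.boundedPoints) {E : Type} {i : B.E → E} {j : T.E → E}
    (hG : Glue i j B.root T.root) {Z : AddSubmonoid (Wt E)}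
    (hZ : ∀ p, p ∈ Z ↔ restrict i p ∈ B.latticePoints ∧ restrict j p ∈ T.boundedPoints) :
    Quad AdmTwo Z := by
  refine hB.glue (hT.evenPart T.typOne_boundedPoints) hG typeSystem_two
    (fun p hp _ => typTwo_of_even (hr p hp)) (fun p hp _ => typTwo_of_even ?_) fun p => ?_
  · have h1 := (TrivalentGraph.mem_latticePoints.1 hp.1.1).1 T.root
    exact ⟨h1, hp.1.2, Int.even_iff.1 hp.2⟩
  · rw [hZ, mem_evenPart]
    refine and_congr_right fun h => (and_iff_left ?_).symm
    -- The weight on the tree's root is the weight on the chain's root, hence even; passing to the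
    -- even part loses nothing.
    rw [restrict_fst, ← hG.comm, Int.even_iff]
    exact (hr _ h).2.2

/-- The path from the root to the chain is absorbed into the tree: gluing `T` to the root of `A.node
B` gives the same graph as gluing `A.node T` to the root of `B`. For this induction `T` and the
gluing maps must be arbitrary. It ends when only the chain is left. -/
theorem IsRootedGamma.quad_glue_tree {g n : ℕ} {B : RootedGraph} (h : IsRootedGamma g n B)
    (hg : g ≠ 0) : ∀ {T : RootedGraph}, Quad AdmOne T.boundedPoints →
      ∀ {E : Type} {i : B.E → E} {j : T.E → E}, Glue i j B.root T.root →
      ∀ {Z : AddSubmonoid (Wt E)},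
        (∀ p, p ∈ Z ↔ restrict i p ∈ B.latticePoints ∧ restrict j p ∈ T.boundedPoints) →
        Quad AdmTwo Z := by
  induction h with
  | line => omega
  | loop =>
    intro T hT E i j hG Z hZ
    obtain ⟨h1, h2⟩ := IsRootedGamma.loop.quad_chain rfl
    exact quad_glue_chain_tree h1 h2 hT hG hZ
  | bigon h _ =>
    intro T hT E i j hG Z hZ
    obtain ⟨h1, h2⟩ := h.bigon.quad_chain rfl
    exact quad_glue_chain_tree h1 h2 hT hG hZ
  | @node g m n A B hA hB _ ih =>
    intro T hT E i j hG Z hZ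
    refine ih hg (quad_node (hA.quad_tree rfl) hT) (i := fun b => i (some (Sum.inr b)))
      (j := fun e => e.elim (i (some (Sum.inr B.root)))
        (Sum.elim (fun a => i (some (Sum.inl a))) j)) ⟨rfl, ?_, ?_⟩ ?_
    · intro x y hxy
      obtain ⟨z, hz1, hz2⟩ := hG.exists_glue
        (fun e => e.elim (y (some (Sum.inr T.root))) (Sum.elim (fun a => y (some (Sum.inl a))) x))
        (fun t => y (some (Sum.inr t))) rfl
      refine ⟨z, funext fun b => congrFun hz1 (some (Sum.inr b)), funext fun e => ?_⟩
      rcases e with _ | a | t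
      · exact (congrFun hz1 (some (Sum.inr B.root))).trans hxy
      · exact congrFun hz1 (some (Sum.inl a))
      · exact congrFun hz2 t
    · intro e
      rcases hG.cover e with ⟨x, rfl⟩ | ⟨t, rfl⟩
      · rcases x with _ | a | b
        · exact Or.inr ⟨some (Sum.inr T.root), hG.comm.symm⟩
        · exact Or.inr ⟨some (Sum.inl a), rfl⟩
        · exact Or.inl ⟨b, rfl⟩
      · exact Or.inr ⟨some (Sum.inr t), rfl⟩
    · intro p
      rw [hZ, boundedPoints_node, mem_node, mem_node, mem_boundedPoints]
      -- The vertex condition is symmetric in the three edges, so it does not matter which of them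
      -- is regarded as the root.
      have hroot : p.1 (j T.root) = p.1 (i none) := congrArg p.1 hG.comm.symm
      constructor
      · rintro ⟨⟨h1, h2, h3⟩, h4, h5⟩
        refine ⟨h2, h1, h4, ?_⟩
        change VertexCond (p.1 (i (some (Sum.inr B.root)))) (p.1 (i (some (Sum.inl A.root))))
          (p.1 (j T.root)) p.2
        rw [hroot]
        replace h3 : VertexCond (p.1 (i none)) (p.1 (i (some (Sum.inl A.root))))
          (p.1 (i (some (Sum.inr B.root)))) p.2 := h3
        unfold VertexCond at h3 ⊢
        omega
      · rintro ⟨h1, h2, h3, h4⟩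
        replace h4 : VertexCond (p.1 (i (some (Sum.inr B.root))))
          (p.1 (i (some (Sum.inl A.root)))) (p.1 (j T.root)) p.2 := h4
        unfold VertexCond at h4
        refine ⟨⟨h2, h1, ?_⟩, h3, ?_⟩
        · change VertexCond (p.1 (i none)) (p.1 (i (some (Sum.inl A.root))))
            (p.1 (i (some (Sum.inr B.root)))) p.2
          unfold VertexCond
          omega
        · simp only [restrict_fst, restrict_snd]
          omega

theorem IsRootedGamma.root_le {g n : ℕ} {B : RootedGraph} (h : IsRootedGamma g n B)
    (hn : 2 < 2 * g + n) : B.boundedPoints = B.latticePoints := by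
  cases h with
  | line => omega
  | loop =>
    ext p
    exact ⟨fun h => h.1, fun h => ⟨h, ((IsRootedGamma.loop.quad_chain rfl).2 p h).2.1⟩⟩
  | bigon h =>
    ext p
    exact ⟨fun h => h.1, fun hp => ⟨hp, ((h.bigon.quad_chain rfl).2 p hp).2.1⟩⟩
  | node _ _ => exact boundedPoints_node _ _

/-- Gluing a single edge to the root does not change the graph, so `quad_glue_tree` applies with `T
= line`. -/
theorem IsRootedGamma.quad {g n : ℕ} {B : RootedGraph} (h : IsRootedGamma g n B) (hg : g ≠ 0) :
    Quad AdmTwo B.latticePoints := by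
  have hn : 2 < 2 * g + n := by
    have := h.one_le.1
    omega
  refine h.quad_glue_tree hg quad_line (i := id) (j := fun _ => B.root)
    ⟨rfl, fun x y hxy => ⟨x, rfl, funext fun _ => hxy⟩, fun e => Or.inl ⟨e, rfl⟩⟩ fun p => ?_
  refine ⟨fun hp => ⟨hp, mem_line.2 ?_, ?_⟩, fun hp => hp.1⟩
  · exact (TrivalentGraph.mem_latticePoints.1 hp).1 B.root
  · rw [← h.root_le hn] at hp
    exact hp.2

/-! ### From factorizations to presentations -/

section Algebra

variable {E : Type} {S : AddSubmonoid (Wt E)}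

/-- Multisets of elements of `S` of level `1` or `2`. -/
def IsLow (S : AddSubmonoid (Wt E)) (F : Multiset (Wt E)) : Prop :=
  ∀ p ∈ F, p ∈ S ∧ (p.2 = 1 ∨ p.2 = 2)

/-- Replace a part of level at most `4` of a multiset by another multiset with the same sum. -/
def SmallMove (S : AddSubmonoid (Wt E)) (F F' : Multiset (Wt E)) : Prop :=
  ∃ N A B, IsLow S N ∧ IsLow S A ∧ IsLow S B ∧ A.sum = B.sum ∧ A.sum.2 ≤ 4 ∧ F = N + A ∧ F' = N + B

/-- Every element of `S` is a sum of elements of levels `1` and `2`, and any two such expressions are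
connected by small moves. -/
structure LowPresented (S : AddSubmonoid (Wt E)) : Prop where
  gen : ∀ s ∈ S, ∃ F, IsLow S F ∧ F.sum = s
  conn : ∀ F F', IsLow S F → IsLow S F' → F.sum = F'.sum → ReflTransGen (SmallMove S) F F'

lemma SmallMove.symm {F F' : Multiset (Wt E)} (h : SmallMove S F F') : SmallMove S F' F := by
  obtain ⟨N, A, B, hN, hA, hB, hs, hl, rfl, rfl⟩ := h
  exact ⟨N, B, A, hN, hB, hA, hs.symm, hs ▸ hl, rfl, rfl⟩

lemma reflTransGen_smallMove_symm {F F' : Multiset (Wt E)}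
    (h : ReflTransGen (SmallMove S) F F') : ReflTransGen (SmallMove S) F' F :=
  haveI : Std.Symm (SmallMove S) := ⟨fun _ _ h => h.symm⟩
  Std.Symm.symm (r := ReflTransGen (SmallMove S)) _ _ h

lemma SmallMove.sum_eq {F F' : Multiset (Wt E)} (h : SmallMove S F F') : F'.sum = F.sum := by
  obtain ⟨N, A, B, hN, hA, hB, hs, hl, rfl, rfl⟩ := h
  simp [hs]

lemma reflTransGen_smallMove_sum_eq {F F' : Multiset (Wt E)}
    (h : ReflTransGen (SmallMove S) F F') : F'.sum = F.sum := by
  induction h with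
  | refl => rfl
  | tail _ h ih => exact h.sum_eq.trans ih

lemma IsLow.cons {F : Multiset (Wt E)} {p : Wt E} (hp : p ∈ S) (hl : p.2 = 1 ∨ p.2 = 2)
    (hF : IsLow S F) : IsLow S (p ::ₘ F) := by
  intro q hq
  rcases Multiset.mem_cons.1 hq with rfl | hq
  · exact ⟨hp, hl⟩
  · exact hF q hq

lemma isLow_zero : IsLow S 0 := fun p hp => by simp at hp

/-- A reduction of the presentation by all elements of levels `1` and `2` to the admissible
factorizations. -/
lemma Quad.lowPresented {adm : Multiset ℕ → Prop} (h : Quad adm S)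
    (hadm : ∀ m, adm m → ∀ l ∈ m, l = 1 ∨ l = 2)
    (hred : ∀ F, IsLow S F → ∃ F', IsFactorization adm S F' ∧ ReflTransGen (SmallMove S) F F') :
    LowPresented S := by
  have low : ∀ F, IsFactorization adm S F → IsLow S F := fun F hF p hp =>
    ⟨hF.1 p hp, hadm _ hF.2 _ (Multiset.mem_map_of_mem _ hp)⟩
  refine ⟨fun s hs => ?_, fun F F' hF hF' hs => ?_⟩
  · obtain ⟨F, hF, hFs⟩ := h.gen s hs
    exact ⟨F, low F hF, hFs⟩
  · obtain ⟨G, hG, hr⟩ := hred F hF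
    obtain ⟨G', hG', hr'⟩ := hred F' hF'
    have hc := h.conn G G' hG hG' (by
      rw [reflTransGen_smallMove_sum_eq hr, reflTransGen_smallMove_sum_eq hr', hs])
    refine hr.trans (ReflTransGen.trans ?_ (reflTransGen_smallMove_symm hr'))
    clear hr hr' hs hG'
    induction hc with
    | refl => rfl
    | @tail G₁ G₂ hc hm ih =>
      refine ih.tail ?_
      have h1 := low _ (reflTransGen_isFactorization hc hG)
      have h2 := low _ (reflTransGen_isFactorization (hc.tail hm) hG)
      obtain ⟨p, q, p', q', N, hp, hq, hp', hq', hs, hl, hl', rfl, rfl⟩ := hm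
      have lp := h1 p (by simp)
      have lq := h1 q (by simp)
      have lp' := h2 p' (by simp)
      have lq' := h2 q' (by simp)
      -- Two members of level at most `2` are exchanged; this is the source of the degree bound `4`.
      refine ⟨N, {p, q}, {p', q'}, fun r hr => h1 r (by simp [hr]), ?_, ?_, ?_, ?_, ?_, ?_⟩
      · exact (isLow_zero.cons lq.1 lq.2).cons lp.1 lp.2
      · exact (isLow_zero.cons lq'.1 lq'.2).cons lp'.1 lp'.2
      · simpa using hs
      · simp only [Multiset.insert_eq_cons, Multiset.sum_cons, Multiset.sum_singleton,
          Prod.snd_add]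
        omega
      · simp [Multiset.insert_eq_cons, add_comm N, Multiset.singleton_add]
      · simp [Multiset.insert_eq_cons, add_comm N, Multiset.singleton_add]

lemma IsLow.of_cons {F : Multiset (Wt E)} {p : Wt E} (h : IsLow S (p ::ₘ F)) : IsLow S F :=
  fun q hq => h q (Multiset.mem_cons_of_mem hq)

lemma reflTransGen_smallMove_cons {F F' : Multiset (Wt E)}
    (h : ReflTransGen (SmallMove S) F F') {p : Wt E} (hp : p ∈ S) (hl : p.2 = 1 ∨ p.2 = 2) :
    ReflTransGen (SmallMove S) (p ::ₘ F) (p ::ₘ F') := by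
  refine h.lift (fun F => p ::ₘ F) ?_
  rintro _ _ ⟨N, A, B, hN, hA, hB, hs, hl', rfl, rfl⟩
  exact ⟨p ::ₘ N, A, B, hN.cons hp hl, hA, hB, hs, hl', by simp, by simp⟩

/-- Quadratic presentations in level `1` are reached by splitting the elements of level `2`. -/
theorem Quad.lowPresented_one (h : Quad AdmOne S) : LowPresented S := by
  refine h.lowPresented (fun m hm l hl => Or.inl (hm l hl)) fun F => ?_
  induction F using Multiset.induction_on with
  | empty => exact fun _ => ⟨0, ⟨by simp, by simp [AdmOne]⟩, ReflTransGen.refl⟩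
  | cons p F ih =>
    intro hF
    obtain ⟨hp, hl⟩ := hF p (by simp)
    obtain ⟨F', hF', hr⟩ := ih hF.of_cons
    obtain ⟨A, hA, hAp⟩ := h.gen p hp
    have lowA : IsLow S A := fun q hq => ⟨hA.1 q hq, Or.inl (hA.2 _ (Multiset.mem_map_of_mem _ hq))⟩
    have lowF' : IsLow S F' :=
      fun q hq => ⟨hF'.1 q hq, Or.inl (hF'.2 _ (Multiset.mem_map_of_mem _ hq))⟩
    refine ⟨F' + A, ⟨?_, ?_⟩, (reflTransGen_smallMove_cons hr hp hl).tail
      ⟨F', {p}, A, lowF', isLow_zero.cons hp hl, lowA, by simp [hAp], ?_, ?_, rfl⟩⟩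
    · intro q hq
      rcases Multiset.mem_add.1 hq with hq | hq
      · exact hF'.1 q hq
      · exact hA.1 q hq
    · intro l hl
      rw [Multiset.map_add] at hl
      rcases Multiset.mem_add.1 hl with hl | hl
      · exact hF'.2 l hl
      · exact hA.2 l hl
    · simp only [Multiset.sum_singleton]
      omega
    · rw [add_comm, Multiset.singleton_add]

/-- Quadratic presentations in level `2` are reached by merging pairs of elements of level `1`. -/
theorem Quad.lowPresented_two (h : Quad AdmTwo S) : LowPresented S := by
  refine h.lowPresented (fun m hm l hl => hm.1 l hl) fun F => ?_
  induction F using Multiset.induction_on with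
  | empty => exact fun _ => ⟨0, ⟨by simp, by simp [AdmTwo]⟩, ReflTransGen.refl⟩
  | cons p F ih =>
    intro hF
    obtain ⟨hp, hl⟩ := hF p (by simp)
    obtain ⟨F', hF', hr⟩ := ih hF.of_cons
    have hr' := reflTransGen_smallMove_cons hr hp hl
    have hF1 : ∀ q ∈ F', q.2 = 1 ∨ q.2 = 2 :=
      fun q hq => hF'.2.1 _ (Multiset.mem_map_of_mem _ hq)
    by_cases hc : p.2 = 1 ∧ (F'.map Prod.snd).count 1 ≠ 0
    · obtain ⟨hp1, hc⟩ := hc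
      rw [Multiset.count_ne_zero, Multiset.mem_map] at hc
      obtain ⟨q, hq, hq1⟩ := hc
      obtain ⟨N, rfl⟩ := Multiset.exists_cons_of_mem hq
      have hqS := hF'.1 q (by simp)
      have hN : IsLow S N := fun r hr => ⟨hF'.1 r (by simp [hr]), hF1 r (by simp [hr])⟩
      have hpq : (p + q).2 = 2 := by simp [hp1, hq1]
      refine ⟨(p + q) ::ₘ N, ⟨?_, ?_, ?_⟩, hr'.tail ⟨N, {p, q}, {p + q}, hN,
        (isLow_zero.cons hqS (Or.inl hq1)).cons hp hl,
        isLow_zero.cons (add_mem hp hqS) (Or.inr hpq), by simp, ?_, ?_, ?_⟩⟩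
      · intro r hr
        rcases Multiset.mem_cons.1 hr with rfl | hr
        · exact add_mem hp hqS
        · exact (hN r hr).1
      · intro l hl
        obtain ⟨r, hr, rfl⟩ := Multiset.mem_map.1 hl
        rcases Multiset.mem_cons.1 hr with rfl | hr
        · exact Or.inr hpq
        · exact (hN r hr).2
      · have := hF'.2.2
        rw [Multiset.map_cons, Multiset.count_cons] at this ⊢
        rw [if_neg (by omega)]
        omega
      · simp [hp1, hq1]
      · simp [Multiset.insert_eq_cons, add_comm N, Multiset.singleton_add]
      · simp [add_comm N, Multiset.singleton_add]
    · refine ⟨p ::ₘ F', ⟨?_, ?_, ?_⟩, hr'⟩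
      · intro r hr
        rcases Multiset.mem_cons.1 hr with rfl | hr
        · exact hp
        · exact hF'.1 r hr
      · intro l hl'
        obtain ⟨r, hr, rfl⟩ := Multiset.mem_map.1 hl'
        rcases Multiset.mem_cons.1 hr with rfl | hr
        · exact hl
        · exact hF1 r hr
      · have := hF'.2.2
        rw [Multiset.map_cons, Multiset.count_cons]
        split_ifs with h1
        · have : ¬ (F'.map Prod.snd).count 1 ≠ 0 := fun h2 => hc ⟨h1.symm, h2⟩
          omega
        · omega

/-! ### Monomials of multisets and the kernel of the presentation -/

open Classical in
/-- The variable of an element of level `1` or `2`. -/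
noncomputable def lowVar (S : AddSubmonoid (Wt E)) (p : Wt E) : MvPolynomial (LowLevel S) ℂ :=
  -- The value `0` is a default; images and degrees of monomials are computed only for multisets
  -- satisfying `IsLow`.
  if h : p ∈ S ∧ (p.2 = 1 ∨ p.2 = 2) then MvPolynomial.X ⟨⟨p, h.1⟩, h.2⟩ else 0

/-- The monomial of a multiset of elements of level `1` or `2`. -/
noncomputable def lowMonomial (S : AddSubmonoid (Wt E)) (F : Multiset (Wt E)) :
    MvPolynomial (LowLevel S) ℂ :=
  (F.map (lowVar S)).prod

lemma lowMonomial_add (F F' : Multiset (Wt E)) :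
    lowMonomial S (F + F') = lowMonomial S F * lowMonomial S F' := by
  simp [lowMonomial]

lemma lowMonomial_cons (p : Wt E) (F : Multiset (Wt E)) :
    lowMonomial S (p ::ₘ F) = lowVar S p * lowMonomial S F := by
  simp [lowMonomial]

lemma presentation_lowMonomial {F : Multiset (Wt E)} (hF : IsLow S F) :
    ∀ hs : F.sum ∈ S, presentation S (lowMonomial S F) =
      AddMonoidAlgebra.single (⟨F.sum, hs⟩ : S) 1 := by
  induction F using Multiset.induction_on with
  | empty =>
    intro hs
    simp only [lowMonomial, Multiset.map_zero, Multiset.prod_zero, map_one]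
    rfl
  | cons p F ih =>
    intro hs
    have hp := hF p (by simp)
    have hs' : F.sum ∈ S := AddSubmonoid.multiset_sum_mem _ _ fun q hq => (hF.of_cons q hq).1
    rw [lowMonomial_cons, map_mul, ih hF.of_cons hs', lowVar, dif_pos hp, presentation,
      MvPolynomial.aeval_X, lowLevelMonomial, AddMonoidAlgebra.single_mul_single, one_mul]
    congr 1
    exact Subtype.ext (by simp)

lemma isWeightedHomogeneous_lowMonomial {F : Multiset (Wt E)} (hF : IsLow S F) :
    MvPolynomial.IsWeightedHomogeneous (fun p : LowLevel S => p.1.1.2) (lowMonomial S F)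
      F.sum.2 := by
  induction F using Multiset.induction_on with
  | empty => exact MvPolynomial.isWeightedHomogeneous_one _ _
  | cons p F ih =>
    have hp := hF p (by simp)
    rw [lowMonomial_cons, Multiset.sum_cons, Prod.snd_add]
    refine MvPolynomial.IsWeightedHomogeneous.mul ?_ (ih hF.of_cons)
    rw [lowVar, dif_pos hp]
    exact MvPolynomial.isWeightedHomogeneous_X _ _ _

/-- The elements of `S` underlying a monomial. -/
noncomputable def underlying (m : LowLevel S →₀ ℕ) : Multiset (Wt E) :=
  (Finsupp.toMultiset m).map fun p => p.1.1

lemma isLow_underlying (m : LowLevel S →₀ ℕ) : IsLow S (underlying m) := by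
  intro p hp
  obtain ⟨q, -, rfl⟩ := Multiset.mem_map.1 hp
  exact ⟨q.1.2, q.2⟩

lemma lowMonomial_underlying (m : LowLevel S →₀ ℕ) :
    lowMonomial S (underlying m) = MvPolynomial.monomial m 1 := by
  have h : (fun p : LowLevel S => lowVar S p.1.1) = MvPolynomial.X := by
    funext p
    rw [lowVar, dif_pos ⟨p.1.2, p.2⟩]
  rw [lowMonomial, underlying, Multiset.map_map]
  change ((Finsupp.toMultiset m).map (fun p : LowLevel S => lowVar S p.1.1)).prod = _
  rw [h, MvPolynomial.monomial_eq, Finsupp.toMultiset_map, Finsupp.prod_toMultiset,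
    Finsupp.prod_mapDomain_index (fun _ => pow_zero _) (fun _ _ _ => pow_add _ _ _), map_one,
    one_mul]

theorem LowPresented.generated (h : LowPresented S) : GeneratedInLevelsOneTwo S := by
  unfold GeneratedInLevelsOneTwo
  rw [Algebra.adjoin_range_eq_range_aeval, AlgHom.range_eq_top]
  intro f
  induction f using AddMonoidAlgebra.induction_linear with
  | zero => exact ⟨0, map_zero _⟩
  | add f g hf hg =>
    obtain ⟨a, rfl⟩ := hf
    obtain ⟨b, rfl⟩ := hg
    exact ⟨a + b, map_add _ _ _⟩
  | single s c =>
    obtain ⟨F, hF, hs⟩ := h.gen s.1 s.2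
    refine ⟨c • lowMonomial S F, ?_⟩
    have := presentation_lowMonomial hF (hs ▸ s.2)
    rw [map_smul]
    change c • presentation S _ = _
    rw [this, AddMonoidAlgebra.smul_single, smul_eq_mul, mul_one]
    congr 1
    exact Subtype.ext hs

/-- A small move changes a monomial by a multiple of a homogeneous binomial relation of degree at
most `4`, so modulo `I` a monomial depends only on its image. Hence the chosen linear section of the
presentation inverts it modulo `I`, and the kernel lies in `I`. -/
theorem LowPresented.relations (h : LowPresented S) : RelationsGeneratedInDegreeLE S 4 := by
  unfold RelationsGeneratedInDegreeLE
  refine le_antisymm ?_ (Ideal.span_le.2 fun f hf => hf.1)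
  set I := Ideal.span {f | f ∈ RingHom.ker (presentation S) ∧
      ∃ k ≤ 4, MvPolynomial.IsWeightedHomogeneous (fun p : LowLevel S => p.1.1.2) f k}
  have mem : ∀ F : Multiset (Wt E), IsLow S F → F.sum ∈ S :=
    fun F hF => AddSubmonoid.multiset_sum_mem _ _ fun q hq => (hF q hq).1
  have move : ∀ F F', SmallMove S F F' → lowMonomial S F - lowMonomial S F' ∈ I := by
    rintro _ _ ⟨N, A, B, hN, hA, hB, hs, hl, rfl, rfl⟩
    rw [lowMonomial_add, lowMonomial_add, ← mul_sub]
    refine Ideal.mul_mem_left _ _ (Ideal.subset_span ⟨?_, A.sum.2, hl, ?_⟩)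
    · rw [RingHom.mem_ker, map_sub, presentation_lowMonomial hA (mem A hA),
        presentation_lowMonomial hB (mem B hB), sub_eq_zero]
      congr 1
      exact Subtype.ext hs
    · refine MvPolynomial.IsWeightedHomogeneous.sub ?_ ?_
      · exact isWeightedHomogeneous_lowMonomial hA
      · rw [hs]
        exact isWeightedHomogeneous_lowMonomial hB
  have conn : ∀ F F', IsLow S F → IsLow S F' → F.sum = F'.sum →
      lowMonomial S F - lowMonomial S F' ∈ I := by
    intro F F' hF hF' hs
    have hr := h.conn F F' hF hF' hs
    clear hs hF'
    induction hr with
    | refl => simp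
    | tail _ hm ih => simpa using add_mem ih (move _ _ hm)
  choose fac hfac using fun s : S => h.gen s.1 s.2
  -- The section sends each basis element `s` to the monomial of one fixed factorization. It is only
  -- linear, which suffices since `key` is checked on monomials.
  let L : AddMonoidAlgebra ℂ S →ₗ[ℂ] MvPolynomial (LowLevel S) ℂ :=
    (AddMonoidAlgebra.basis S ℂ).constr ℂ fun s => lowMonomial S (fac s)
  have key : ∀ f, f - L (presentation S f) ∈ I := by
    intro f
    induction f using MvPolynomial.induction_on' with
    | monomial m c =>
      have hm : MvPolynomial.monomial m c = c • lowMonomial S (underlying m) := by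
        rw [lowMonomial_underlying, MvPolynomial.smul_monomial, smul_eq_mul, mul_one]
      have hlow := isLow_underlying m
      have hL : L (presentation S (lowMonomial S (underlying m))) =
          lowMonomial S (fac ⟨_, mem _ hlow⟩) := by
        rw [presentation_lowMonomial hlow (mem _ hlow), ← AddMonoidAlgebra.basis_apply]
        exact (AddMonoidAlgebra.basis S ℂ).constr_basis ℂ _ _
      rw [hm, map_smul, map_smul, hL, ← smul_sub]
      exact Submodule.smul_of_tower_mem I c
        (conn _ _ hlow (hfac _).1 (hfac ⟨_, mem _ hlow⟩).2.symm)
    | add f g hf hg =>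
      have := add_mem hf hg
      rw [map_add, map_add]
      convert this using 1
      ring
  intro f hf
  have := key f
  rw [RingHom.mem_ker] at hf
  rwa [hf, map_zero, sub_zero] at this

end Algebra

theorem theorem1p3 :
    (∀ (g n : ℕ) (Γ : TrivalentGraph), IsGamma g n Γ →
      GeneratedInLevelsOneTwo Γ.latticePoints ∧
      RelationsGeneratedInDegreeLE Γ.latticePoints 4) ∧
    -- the case `n = 0` in the form `P_{g,0} ⊆ P_{g,1}`, which also makes sense for `g = 1`
    (∀ (g : ℕ) (A : RootedGraph), IsRootedGamma g 1 A →
      GeneratedInLevelsOneTwo A.rootZeroPoints ∧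
      RelationsGeneratedInDegreeLE A.rootZeroPoints 4) := by
  refine ⟨fun g n Γ h => ?_, fun g A h => ?_⟩
  · have : LowPresented Γ.latticePoints := by
      cases h with
      | leaves h hn =>
        by_cases hg : g = 0
        · have := h.quad_tree hg
          rw [h.root_le hn] at this
          exact this.lowPresented_one
        · exact (h.quad hg).lowPresented_two
      | noLeaves h =>
        obtain ⟨h1, h2⟩ := h.quad_chain rfl
        exact (RootedGraph.quad_close h1 h2).lowPresented_two
    exact ⟨this.generated, this.relations⟩
  · obtain ⟨h1, h2⟩ := h.quad_chain rfl
    -- `rootZeroPoints` is by definition the face at the root of the lattice points of the chain.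
    have : LowPresented A.rootZeroPoints :=
      (h1.face A.root fun p hp => (h2 p hp).1).lowPresented_two
    exact ⟨this.generated, this.relations⟩
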